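/- Let $\lambda>0$, $c>0$, $0<p<1$, and let $d_j=(\cos(\pi j/2),\sin(\pi j/2))$, with $j$ taken modulo $4$. A particle starts from the origin of $\mathbb R^2$ at time $0$ and moves with constant speed $c$; its initial direction is uniformly distributed on $\{d_0,d_1,d_2,d_3\}$, and its direction changes exactly at the events of a homogeneous Poisson process of intensity $\lambda$. At each event, if the particle is moving horizontally (along $d_0$ or $d_2$) it turns counterclockwise (from $d_j$ to $d_{j+1}$) with probability $p$ and clockwise (from $d_j$ to $d_{j-1}$) with probability $1-p$; if it is moving vertically (along $d_1$ or $d_3$) it turns counterclockwise with probability $1-p$ and clockwise with probability $p$. The sequence of successive directions is a Markov chain independent of the Poisson process. Let $(X(t),Y(t))$ be the position of the particle at time $t$, and let $I_0(z)=\sum_{k\ge 0}\frac{(z/2)^{2k}}{(k!)^2}$ be the modified Bessel function of order zero. Then, for every $t>0$, the law of $(X(t),Y(t))$ restricted to the open square $\{(x,y):|x|+|y|<ct\}$ is absolutely continuous with respect to the Lebesgue measure, with density, for $|x|+|y|<ct$, $$f(x,y,t)=\frac{e^{-\lambda t}}{2c^2}\left[\lambda(1-p)\,I_0\!\left(\tfrac{\lambda(1-p)}{c}\sqrt{c^2t^2-(x+y)^2}\right)+\frac{\partial}{\partial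 t}I_0\!\left(\tfrac{\lambda(1-p)}{c}\sqrt{c^2t^2-(x+y)^2}\right)\right]$$ $$\qquad\cdot\left[\lambda p\,I_0\!\left(\tfrac{\lambda p}{c}\sqrt{c^2t^2-(x-y)^2}\right)+\frac{\partial}{\partial t}I_0\!\left(\tfrac{\lambda p}{c}\sqrt{c^2t^2-(x-y)^2}\right)\right].$$ In particular, the derivatives with respect to $t$ in this formula exist. That is, $f(\cdot,\cdot,t)$ is integrable on the open square, and $\mathbb P\big((X(t),Y(t))\in A\big)=\iint_A f(x,y,t)\,dx\,dy$ for every Borel subset $A$ of the open square. -/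

import Mathlib

open MeasureTheory ProbabilityTheory
open scoped NNReal

namespace PlanarMotion

/-- The modified Bessel function of the first kind of order zero,
`I₀(z) = ∑ₖ (z / 2) ^ (2 k) / (k!) ^ 2`. -/
noncomputable def besselI0 (z : ℝ) : ℝ :=
  ∑' k : ℕ, (z / 2) ^ (2 * k) / (k.factorial : ℝ) ^ 2

/-- The series defining `I₀` converges for every real argument. -/
theorem summable_besselI0 (z : ℝ) :
    Summable fun k : ℕ => (z / 2) ^ (2 * k) / (k.factorial : ℝ) ^ 2 := by
  refine Summable.of_nonneg_of_le (fun k => ?_) (fun k => ?_)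
    (Real.summable_pow_div_factorial ((z / 2) ^ 2))
  · rw [pow_mul]; positivity
  · rw [pow_mul]
    have h1 : (1 : ℝ) ≤ (k.factorial : ℝ) := by exact_mod_cast k.factorial_pos
    refine div_le_div_of_nonneg_left (by positivity) (by positivity) ?_
    nlinarith

variable {Ω : Type*} [MeasurableSpace Ω]

/-- `N` is a homogeneous Poisson process with intensity `lam` on `(Ω, P)`: it starts from `0`, has
independent Poisson distributed increments and, almost surely, nondecreasing right-continuous
paths. (Along nondecreasing paths the subtraction of natural numbers is the true one.) -/
structure IsPoissonProcess (N : ℝ≥0 → Ω → ℕ) (lam : ℝ) (P : Measure Ω) : Prop where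
  measurable : ∀ t, Measurable (N t)
  zero : ∀ᵐ ω ∂P, N 0 ω = 0
  monotone : ∀ᵐ ω ∂P, Monotone fun t => N t ω
  rightContinuous : ∀ᵐ ω ∂P, ∀ t, ContinuousWithinAt (fun s => N s ω) (Set.Ici t) t
  indepIncrements : HasIndepIncrements N P
  law_increment : ∀ s t : ℝ≥0, s ≤ t →
    HasLaw (fun ω => N t ω - N s ω) (poissonMeasure (lam.toNNReal * (t - s))) P

/-- The probability that, at a switch, a particle moving along `d_i` turns to `d_j`. Indices are
taken modulo `4`; `d_0`, `d_2` are horizontal and `d_1`, `d_3` are vertical. A particle moving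
horizontally turns counterclockwise with probability `p` and clockwise with probability `1 - p`; a
particle moving vertically turns counterclockwise with probability `1 - p` and clockwise with
probability `p`. -/
def turnProb (p : ℝ) (i j : Fin 4) : ℝ :=
  if j = i + 1 then (if i = 0 ∨ i = 2 then p else 1 - p)
  else if j = i - 1 then (if i = 0 ∨ i = 2 then 1 - p else p)
  else 0

/-- `ξ n` is (the index of) the direction taken after `n` switches: the initial direction is
uniform on the four directions and the successive turns follow the rule `turnProb p`, each
depending on the past only through the current direction. -/
structure IsDirectionChain (ξ : ℕ → Ω → Fin 4) (p : ℝ) (P : Measure Ω) : Prop where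
  measurable : ∀ n, Measurable (ξ n)
  law_path : ∀ (n : ℕ) (a : ℕ → Fin 4),
    P.real {ω | ∀ k ≤ n, ξ k ω = a k} =
      1 / 4 * ∏ k ∈ Finset.range n, turnProb p (a k) (a (k + 1))

/-- The random mechanism of the motion: switches occur at the events of a Poisson process `N` of
intensity `lam`, and the successive directions `ξ` follow the turning rule, independently of the
switching times. -/
structure IsDirectionMechanism (N : ℝ≥0 → Ω → ℕ) (ξ : ℕ → Ω → Fin 4) (lam p : ℝ)
    (P : Measure Ω) : Prop where
  poisson : IsPoissonProcess N lam P
  chain : IsDirectionChain ξ p P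
  indep : IndepFun (fun ω (t : ℝ≥0) => N t ω) (fun ω (n : ℕ) => ξ n ω) P

/-- The index of the direction `D(t)` at time `t`. -/
def direction (N : ℝ≥0 → Ω → ℕ) (ξ : ℕ → Ω → Fin 4) (t : ℝ≥0) (ω : Ω) : Fin 4 :=
  ξ (N t ω) ω

/-- The unit vector `d_j = (cos (π j / 2), sin (π j / 2))`. -/
noncomputable def dirVec (j : Fin 4) : ℝ × ℝ :=
  (Real.cos (Real.pi * (j : ℕ) / 2), Real.sin (Real.pi * (j : ℕ) / 2))

/-- The position `(X(t), Y(t))` at time `t ≥ 0` of the particle that starts from the origin and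
moves with velocity `c d_{D(s)}` at each time `s`. -/
noncomputable def position (N : ℝ≥0 → Ω → ℕ) (ξ : ℕ → Ω → Fin 4) (c t : ℝ) (ω : Ω) : ℝ × ℝ :=
  (∫ s in (0 : ℝ)..t, c * (dirVec (direction N ξ s.toNNReal ω)).1,
   ∫ s in (0 : ℝ)..t, c * (dirVec (direction N ξ s.toNNReal ω)).2)

/-- The open square `|x| + |y| < c t`. -/
def openSquare (c t : ℝ) : Set (ℝ × ℝ) := {z | |z.1| + |z.2| < c * t}

/-- The explicit density of the position in the interior of the square. -/
noncomputable def interiorDensity (lam p c x y t : ℝ) : ℝ :=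
  Real.exp (-(lam * t)) / (2 * c ^ 2) *
    (lam * (1 - p) *
        besselI0 (lam * (1 - p) / c * Real.sqrt (c ^ 2 * t ^ 2 - (x + y) ^ 2)) +
      deriv (fun s : ℝ =>
        besselI0 (lam * (1 - p) / c * Real.sqrt (c ^ 2 * s ^ 2 - (x + y) ^ 2))) t) *
    (lam * p *
        besselI0 (lam * p / c * Real.sqrt (c ^ 2 * t ^ 2 - (x - y) ^ 2)) +
      deriv (fun s : ℝ =>
        besselI0 (lam * p / c * Real.sqrt (c ^ 2 * s ^ 2 - (x - y) ^ 2))) t)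

end PlanarMotion

/-!
In the coordinates `U = X + Y`, `V = X - Y` every turn reverses exactly one of the two velocities:
`U` and `V` are independent telegraph processes with rates of reversal `λ(1 - p)` and `λp`. To see
this, sample the motion on a grid of mesh `t / m`. The characteristic function of `(U, V)` becomes
the limit of the `m`-th powers of a product of two matrix exponentials, which the Lie–Trotter
formula evaluates as `exp (t G)`. The matrix `G` is, up to a multiple of the identity, the sum of
two commuting matrices whose squares are scalars, so that `exp (t G)` factors into explicit
telegraph characteristic functions. These are also the Fourier transforms of the laws with atoms at
`±ct` and a Bessel density in between, as one sees by integrating power series term by term. The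
linear change of variables `(X, Y) ↦ (U, V)` then gives the density of the position.
-/

namespace PlanarMotion

open Filter Topology

section MarkovChain

variable {Ω S 𝕜 : Type*} [MeasurableSpace Ω] [RCLike 𝕜] {P : Measure Ω}

theorem measureReal_prodMk_mem_of_indepFun [IsFiniteMeasure P] {α β : Type*} [MeasurableSpace α]
    [MeasurableSpace β] {U : Ω → α} {V : Ω → β} (hU : Measurable U) (hV : Measurable V)
    (hUV : IndepFun U V P) {E : Set (α × β)} (hE : MeasurableSet E) :
    P.real {ω | (U ω, V ω) ∈ E} = ∫ ω, P.real {ω' | (U ω, V ω') ∈ E} ∂P := by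
  have : IsFiniteMeasure (P.map U) := Measure.isFiniteMeasure_map P U
  have : IsFiniteMeasure (P.map V) := Measure.isFiniteMeasure_map P V
  calc P.real {ω | (U ω, V ω) ∈ E}
    _ = (P.map fun ω => (U ω, V ω)).real E := (map_measureReal_apply (hU.prodMk hV) hE).symm
    _ = ∫ u, (P.map V).real (Prod.mk u ⁻¹' E) ∂P.map U := by
      rw [(indepFun_iff_map_prod_eq_prod_map_map hU.aemeasurable hV.aemeasurable).1 hUV,
        measureReal_def, Measure.prod_apply hE]
      exact (integral_toReal (measurable_measure_prodMk_left hE).aemeasurable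
        (.of_forall fun _ => measure_lt_top _ _)).symm
    _ = ∫ ω, P.real {ω' | (U ω, V ω') ∈ E} ∂P := by
      have hfibre : Measurable fun u => (P.map V).real (Prod.mk u ⁻¹' E) :=
        (measurable_measure_prodMk_left hE).ennreal_toReal
      rw [integral_map hU.aemeasurable hfibre.aestronglyMeasurable]
      simp only [map_measureReal_apply hV (measurable_prodMk_left hE)]
      rfl

theorem measurable_snd_apply_fst [MeasurableSpace S] :
    Measurable fun z : ℕ × (ℕ → S) => z.2 z.1 :=
  measurable_from_prod_countable_right fun n => measurable_pi_apply n

theorem measurable_apply_sum [MeasurableSpace S] (k : ℕ) :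
    Measurable fun z : (ℕ → ℕ) × (ℕ → S) => z.2 (∑ i ∈ Finset.range k, z.1 i) := by
  have hsum : Measurable fun z : (ℕ → ℕ) × (ℕ → S) => ∑ i ∈ Finset.range k, z.1 i := by fun_prop
  exact measurable_snd_apply_fst.comp (hsum.prodMk measurable_snd)

theorem integral_comp_eq_sum [IsFiniteMeasure P] [Fintype S] [MeasurableSpace S]
    [MeasurableSingletonClass S] {f : Ω → S} (hf : Measurable f) (g : S → 𝕜) :
    ∫ ω, g (f ω) ∂P = ∑ a, (P.real (f ⁻¹' {a}) : 𝕜) * g a := by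
  have : IsFiniteMeasure (P.map f) := Measure.isFiniteMeasure_map P f
  rw [← integral_map hf.aemeasurable (by fun_prop), integral_fintype (.of_finite)]
  simp [map_measureReal_apply hf, RCLike.real_smul_eq_coe_mul]

/-- The infinite path that agrees with `a` up to time `n`; its later values are irrelevant. -/
def extendPath {n : ℕ} (a : Fin (n + 1) → S) (k : ℕ) : S := a (Fin.ofNat (n + 1) k)

theorem extendPath_of_le {n k : ℕ} (a : Fin (n + 1) → S) (hk : k ≤ n) :
    extendPath a k = a ⟨k, Nat.lt_succ_of_le hk⟩ := by
  simp [extendPath, Fin.ofNat, Nat.mod_eq_of_lt (Nat.lt_succ_of_le hk)]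

/-- `X` is a Markov chain under `P` with finite state space `S`, initial weights `π` and transition
matrix `Q`, characterised by the probabilities of its finite paths. -/
structure IsMarkovChain [MeasurableSpace S] (X : ℕ → Ω → S) (π : S → ℝ)
    (Q : Matrix S S ℝ) (P : Measure Ω) : Prop where
  measurable : ∀ n, Measurable (X n)
  law_path : ∀ (n : ℕ) (a : ℕ → S),
    P.real {ω | ∀ k ≤ n, X k ω = a k} = π (a 0) * ∏ k ∈ Finset.range n, Q (a k) (a (k + 1))

namespace IsMarkovChain

variable [Fintype S] [MeasurableSpace S] [MeasurableSingletonClass S] [IsFiniteMeasure P]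
  {X : ℕ → Ω → S} {π : S → ℝ} {Q : Matrix S S ℝ}

theorem integral_eq_sum_paths (hX : IsMarkovChain X π Q P) {n : ℕ} {F : (ℕ → S) → 𝕜}
    (hF : DependsOn F (Set.Iic n)) :
    ∫ ω, F (fun k => X k ω) ∂P = ∑ a : Fin (n + 1) → S,
      ((π (extendPath a 0) * ∏ k ∈ Finset.range n, Q (extendPath a k) (extendPath a (k + 1)) : ℝ)
        : 𝕜) * F (extendPath a) := by
  have hprefix : Measurable fun ω (k : Fin (n + 1)) => X k ω :=
    measurable_pi_lambda _ fun k => hX.measurable k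
  have hext (ω : Ω) : F (fun k => X k ω) = F (extendPath fun k : Fin (n + 1) => X k ω) :=
    hF fun k hk => by rw [extendPath_of_le _ (Set.mem_Iic.1 hk)]
  simp only [hext, integral_comp_eq_sum hprefix fun a => F (extendPath a)]
  refine Finset.sum_congr rfl fun a _ => ?_
  rw [← hX.law_path]
  congr 4
  ext ω
  simp only [Set.mem_preimage, Set.mem_singleton_iff, funext_iff, Set.mem_ofPred_eq]
  refine ⟨fun h k hk => ?_, fun h k => ?_⟩
  · rw [extendPath_of_le a hk, ← h]
  · rw [h k k.is_le, extendPath_of_le a k.is_le]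

theorem integral_mul_comp_succ (hX : IsMarkovChain X π Q P) {n : ℕ} {G : (ℕ → S) → 𝕜}
    (hG : DependsOn G (Set.Iic n)) (f : S → 𝕜) :
    ∫ ω, G (fun k => X k ω) * f (X (n + 1) ω) ∂P =
      ∫ ω, G (fun k => X k ω) * (Q.map (algebraMap ℝ 𝕜)).mulVec f (X n ω) ∂P := by
  have hnext : DependsOn (fun x => G x * f (x (n + 1))) (Set.Iic (n + 1)) := fun x y h => by
    simp only [h _ (Set.mem_Iic.2 le_rfl),
      hG fun k hk => h k ((Set.mem_Iic.1 hk).trans n.le_succ)]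
  have hlast : DependsOn (fun x => G x * (Q.map (algebraMap ℝ 𝕜)).mulVec f (x n)) (Set.Iic n) :=
    fun x y h => by simp only [h _ (Set.mem_Iic.2 le_rfl), hG h]
  rw [hX.integral_eq_sum_paths hnext, hX.integral_eq_sum_paths hlast,
    ← (Fin.snocEquiv fun _ => S).sum_comp, Fintype.sum_prod_type_right]
  refine Finset.sum_congr rfl fun a _ => ?_
  have hold (j : S) {k : ℕ} (hk : k ≤ n) :
      extendPath (Fin.snocEquiv (fun _ : Fin (n + 2) => S) (j, a)) k = extendPath a k := by
    rw [extendPath_of_le _ (hk.trans n.le_succ), extendPath_of_le _ hk]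
    exact Fin.snoc_castSucc (α := fun _ => S) (p := a) (i := ⟨k, Nat.lt_succ_of_le hk⟩) ..
  have hnew (j : S) :
      extendPath (Fin.snocEquiv (fun _ : Fin (n + 2) => S) (j, a)) (n + 1) = j := by
    rw [extendPath_of_le _ le_rfl]
    exact Fin.snoc_last (α := fun _ => S) ..
  have hG' (j : S) : G (extendPath (Fin.snocEquiv (fun _ : Fin (n + 2) => S) (j, a))) =
      G (extendPath a) := hG fun k hk => hold j hk
  have hprod (j : S) : ∏ k ∈ Finset.range n,
      Q (extendPath (Fin.snocEquiv (fun _ : Fin (n + 2) => S) (j, a)) k)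
        (extendPath (Fin.snocEquiv (fun _ : Fin (n + 2) => S) (j, a)) (k + 1)) =
      ∏ k ∈ Finset.range n, Q (extendPath a k) (extendPath a (k + 1)) :=
    Finset.prod_congr rfl fun k hk => by
      rw [hold j (Finset.mem_range.1 hk).le, hold j (Finset.mem_range.1 hk)]
  simp only [Finset.prod_range_succ, hold _ n.zero_le, hold _ le_rfl, hnew, hG', hprod,
    Matrix.mulVec, dotProduct, Matrix.map_apply, Finset.mul_sum]
  refine Finset.sum_congr rfl fun j _ => ?_
  push_cast
  simp only [RCLike.algebraMap_eq_ofReal]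
  ring

variable [DecidableEq S]

theorem integral_mul_comp_add (hX : IsMarkovChain X π Q P) {n : ℕ} {G : (ℕ → S) → 𝕜}
    (hG : DependsOn G (Set.Iic n)) (k : ℕ) (f : S → 𝕜) :
    ∫ ω, G (fun k => X k ω) * f (X (n + k) ω) ∂P =
      ∫ ω, G (fun k => X k ω) * (Q.map (algebraMap ℝ 𝕜) ^ k).mulVec f (X n ω) ∂P := by
  induction k generalizing f with
  | zero => simp
  | succ k ih =>
    rw [← add_assoc, hX.integral_mul_comp_succ
      (hG.mono (Set.Iic_subset_Iic.2 (Nat.le_add_right n k))), ih, Matrix.mulVec_mulVec, pow_succ]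

theorem measureReal_inter_comp_add (hX : IsMarkovChain X π Q P) {n : ℕ} {B : Set (ℕ → S)}
    (hBm : MeasurableSet B) (hB : DependsOn (· ∈ B) (Set.Iic n)) {i : S} (hi : ∀ x ∈ B, x n = i)
    (k : ℕ) (j : S) :
    P.real ((fun ω k => X k ω) ⁻¹' B ∩ X (n + k) ⁻¹' {j}) =
      P.real ((fun ω k => X k ω) ⁻¹' B) * (Q ^ k) i j := by
  have hpath : Measurable fun ω k => X k ω := measurable_pi_lambda _ hX.measurable
  have hG : DependsOn (B.indicator fun _ => (1 : ℝ)) (Set.Iic n) := fun x y h => by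
    classical simp only [Set.indicator_apply, hB h]
  rw [← integral_indicator_one (hpath hBm), ← integral_mul_const, ← integral_indicator_one
    ((hpath hBm).inter (hX.measurable (n + k) (measurableSet_singleton j)))]
  have hstep := hX.integral_mul_comp_add hG k (Pi.single j 1)
  rw [Matrix.mulVec_single_one, Algebra.algebraMap_self, RingHom.coe_id, Matrix.map_id] at hstep
  refine Eq.trans (integral_congr_ae (.of_forall fun ω => ?_))
    (hstep.trans (integral_congr_ae (.of_forall fun ω => ?_)))
  · by_cases hpast : (fun k => X k ω) ∈ B <;> by_cases hj : X (n + k) ω = j <;> simp [hpast, hj]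
  · by_cases h : (fun k => X k ω) ∈ B
    · simp [h, hi _ h]
    · simp [h]

theorem measureReal_path_sum (hX : IsMarkovChain X π Q P) (κ : ℕ → ℕ) (m : ℕ) (a : ℕ → S) :
    P.real {ω | ∀ k ≤ m, X (∑ i ∈ Finset.range k, κ i) ω = a k} =
      π (a 0) * ∏ k ∈ Finset.range m, (Q ^ κ k) (a k) (a (k + 1)) := by
  induction m with
  | zero => simpa using hX.law_path 0 a
  | succ m ih =>
    let B : Set (ℕ → S) := {x | ∀ k ≤ m, x (∑ i ∈ Finset.range k, κ i) = a k}
    have hBm : MeasurableSet B := by measurability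
    have hB : DependsOn (· ∈ B) (Set.Iic (∑ i ∈ Finset.range m, κ i)) := fun x y h =>
      propext <| forall₂_congr fun k hk => by
        rw [h _ (Set.mem_Iic.2 (Finset.sum_le_sum_of_subset (Finset.range_mono hk)))]
    rw [Finset.prod_range_succ, ← mul_assoc, ← ih]
    refine Eq.trans ?_ (hX.measureReal_inter_comp_add hBm hB (fun x hx => hx m le_rfl) (κ m)
      (a (m + 1)))
    congr 1 with ω
    simp [B, Nat.le_succ_iff, or_imp, forall_and, Finset.sum_range_succ]

theorem integral_prod_mul (hX : IsMarkovChain X π Q P) (w f : S → 𝕜) (m : ℕ) :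
    ∫ ω, (∏ k ∈ Finset.range m, w (X k ω)) * f (X m ω) ∂P =
      (fun i => (π i : 𝕜)) ⬝ᵥ
        ((Matrix.diagonal w * Q.map (algebraMap ℝ 𝕜)) ^ m).mulVec f := by
  induction m generalizing f with
  | zero =>
    have hlaw (i : S) : P.real (X 0 ⁻¹' {i}) = π i := by
      simpa [Set.preimage, Set.mem_singleton_iff] using hX.law_path 0 fun _ => i
    simp [integral_comp_eq_sum (hX.measurable 0), dotProduct, hlaw]
  | succ m ih =>
    have hG : DependsOn (fun x : ℕ → S => ∏ k ∈ Finset.range (m + 1), w (x k)) (Set.Iic m) :=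
      fun x y h => Finset.prod_congr rfl fun k hk => by
        rw [h k (Nat.lt_succ_iff.1 (Finset.mem_range.1 hk))]
    rw [hX.integral_mul_comp_succ hG, pow_succ, ← Matrix.mulVec_mulVec, ← ih]
    simp only [← Matrix.mulVec_mulVec, Matrix.mulVec_diagonal, Finset.prod_range_succ, mul_assoc]

theorem comp_sum {κ : ℕ → Ω → ℕ} {ν : Measure ℕ} (hX : IsMarkovChain X π Q P)
    (hκm : ∀ k, Measurable (κ k)) (hlaw : ∀ k, HasLaw (κ k) ν P) (hκ : iIndepFun κ P)
    (hκX : IndepFun (fun ω k => κ k ω) (fun ω k => X k ω) P) :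
    IsMarkovChain (fun k ω => X (∑ i ∈ Finset.range k, κ i ω) ω) π
      (Matrix.of fun i j => ∫ n, (Q ^ n) i j ∂ν) P where
  measurable k := (measurable_apply_sum k).comp
    ((measurable_pi_lambda _ hκm).prodMk (measurable_pi_lambda _ hX.measurable))
  law_path m a := by
    have hE : MeasurableSet
        {z : (ℕ → ℕ) × (ℕ → S) | ∀ k ≤ m, z.2 (∑ i ∈ Finset.range k, z.1 i) = a k} := by
      simp only [Set.ofPred_forall]
      exact .iInter fun k => .iInter fun _ =>
        measurable_apply_sum k (measurableSet_singleton (a k))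
    calc P.real {ω | ∀ k ≤ m, X (∑ i ∈ Finset.range k, κ i ω) ω = a k}
      _ = ∫ ω, P.real {ω' | ∀ k ≤ m, X (∑ i ∈ Finset.range k, κ i ω) ω' = a k} ∂P :=
        measureReal_prodMk_mem_of_indepFun (measurable_pi_lambda _ hκm)
          (measurable_pi_lambda _ hX.measurable) hκX hE
      _ = π (a 0) * ∫ ω, ∏ k : Fin m, (Q ^ κ k ω) (a k) (a (k + 1)) ∂P := by
        simp only [hX.measureReal_path_sum fun i => κ i _, integral_const_mul,
          Finset.prod_range]
      _ = π (a 0) * ∏ k : Fin m, ∫ ω, (Q ^ κ k ω) (a k) (a (k + 1)) ∂P := by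
        rw [(hκ.precomp Fin.val_injective).integral_fun_prod_comp
          (f := fun (k : Fin m) n => (Q ^ n) (a k) (a (k + 1)))
          (fun k => (hκm k).aemeasurable) fun k => by fun_prop]
      _ = _ := by
        rw [Finset.prod_range]
        congr! 2 with k
        exact (hlaw k).integral_comp (f := fun n => (Q ^ n) (a k) (a (k + 1))) (by fun_prop)

end IsMarkovChain

end MarkovChain

section LieTrotter

variable {𝔸 : Type*} [NormedRing 𝔸]

theorem norm_pow_sub_pow_le [NormOneClass 𝔸] {a b : 𝔸} {K : ℝ} (ha : ‖a‖ ≤ K) (hb : ‖b‖ ≤ K)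
    (n : ℕ) : ‖a ^ n - b ^ n‖ ≤ n * K ^ (n - 1) * ‖a - b‖ := by
  have hK : 0 ≤ K := (norm_nonneg a).trans ha
  induction n with
  | zero => simp
  | succ n ih =>
    have hKn : (n : ℝ) * K ^ (n - 1) * K = n * K ^ n := by
      cases n <;> simp [pow_succ, mul_assoc]
    calc ‖a ^ (n + 1) - b ^ (n + 1)‖
      _ = ‖a ^ n * (a - b) + (a ^ n - b ^ n) * b‖ := by congr 1; noncomm_ring
      _ ≤ K ^ n * ‖a - b‖ + n * K ^ (n - 1) * ‖a - b‖ * K := by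
        refine (norm_add_le _ _).trans (add_le_add ?_ ?_)
        · exact (norm_mul_le _ _).trans (by grw [norm_pow_le, ha])
        · exact (norm_mul_le _ _).trans (by grw [ih, hb])
      _ = _ := by
        rw [mul_right_comm _ ‖a - b‖, hKn]
        push_cast
        ring

variable [NormedAlgebra ℝ 𝔸]

theorem tendsto_pow_sub_pow [NormOneClass 𝔸] {a b : ℕ → 𝔸} {A : 𝔸}
    (ha : Tendsto (fun m : ℕ => (m : ℝ) • (a m - 1)) atTop (𝓝 A))
    (hb : Tendsto (fun m : ℕ => (m : ℝ) • (b m - 1)) atTop (𝓝 A)) :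
    Tendsto (fun m : ℕ => a m ^ m - b m ^ m) atTop (𝓝 0) := by
  set C := ‖A‖ + 1
  have hle {x : 𝔸} {m : ℕ} (hm : 0 < m) (hx : ‖(m : ℝ) • (x - 1)‖ < C) :
      ‖x‖ ≤ Real.exp (C / m) := by
    have hm' : (0 : ℝ) < m := by exact_mod_cast hm
    have hx' : ‖x - 1‖ ≤ C / m := by
      rw [norm_smul, RCLike.norm_natCast] at hx
      exact (le_div_iff₀' hm').2 hx.le
    calc ‖x‖ ≤ ‖x - 1‖ + ‖(1 : 𝔸)‖ := norm_le_norm_sub_add x 1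
      _ ≤ C / m + 1 := by grw [hx', norm_one]
      _ ≤ Real.exp (C / m) := Real.add_one_le_exp _
  have hdiff : Tendsto (fun m : ℕ => Real.exp C * ‖(m : ℝ) • (a m - b m)‖) atTop (𝓝 0) := by
    have := (ha.sub hb).norm.const_mul (Real.exp C)
    simpa only [sub_self, norm_zero, mul_zero, ← smul_sub, sub_sub_sub_cancel_right] using this
  refine squeeze_zero_norm' ?_ hdiff
  have hC : ‖A‖ < C := lt_add_one _
  filter_upwards [eventually_gt_atTop 0, ha.norm.eventually_lt_const hC,
    hb.norm.eventually_lt_const hC] with m hm ham hbm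
  have hm' : (m : ℝ) ≠ 0 := by exact_mod_cast hm.ne'
  calc ‖a m ^ m - b m ^ m‖
    _ ≤ m * Real.exp (C / m) ^ (m - 1) * ‖a m - b m‖ :=
      norm_pow_sub_pow_le (hle hm ham) (hle hm hbm) m
    _ ≤ m * Real.exp (C / m) ^ m * ‖a m - b m‖ := by
      gcongr
      · exact Real.one_le_exp (by positivity)
      · exact Nat.sub_le m 1
    _ = Real.exp C * ‖(m : ℝ) • (a m - b m)‖ := by
      rw [← Real.exp_nat_mul, mul_div_cancel₀ C hm', norm_smul, RCLike.norm_natCast]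
      ring

theorem tendsto_smul_sub_one {f : ℝ → 𝔸} {A : 𝔸} (hf : HasDerivAt f A 0) (h0 : f 0 = 1) :
    Tendsto (fun m : ℕ => (m : ℝ) • (f (m : ℝ)⁻¹ - 1)) atTop (𝓝 A) := by
  have hinv : Tendsto (fun m : ℕ => (m : ℝ)⁻¹) atTop (𝓝[≠] 0) :=
    (tendsto_inv_atTop_nhdsGT_zero.comp tendsto_natCast_atTop_atTop).mono_right
      (nhdsWithin_mono _ fun _ => ne_of_gt)
  simpa [Function.comp_def, h0] using (hasDerivAt_iff_tendsto_slope_zero.1 hf).comp hinv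

variable [NormOneClass 𝔸] [CompleteSpace 𝔸]

theorem tendsto_pow_exp {a : ℕ → 𝔸} {A : 𝔸}
    (ha : Tendsto (fun m : ℕ => (m : ℝ) • (a m - 1)) atTop (𝓝 A)) :
    Tendsto (fun m : ℕ => a m ^ m) atTop (𝓝 (NormedSpace.exp A)) := by
  let +nondep : NormedAlgebra ℚ 𝔸 := .restrictScalars ℚ ℝ 𝔸
  have hderiv : HasDerivAt (fun s : ℝ => NormedSpace.exp (s • A)) A 0 := by
    simpa using hasDerivAt_exp_smul_const (𝕂 := ℝ) A (0 : ℝ)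
  have hdiff := tendsto_pow_sub_pow ha (tendsto_smul_sub_one hderiv (by simp))
  refine tendsto_sub_nhds_zero_iff.1 (hdiff.congr' ?_)
  filter_upwards [eventually_gt_atTop 0] with m hm
  have hm' : (m : ℝ) ≠ 0 := by exact_mod_cast hm.ne'
  rw [← NormedSpace.exp_nsmul, ← Nat.cast_smul_eq_nsmul ℝ, smul_smul, mul_inv_cancel₀ hm',
    one_smul]

theorem tendsto_exp_mul_exp_pow (A B : 𝔸) :
    Tendsto (fun m : ℕ => (NormedSpace.exp ((m : ℝ)⁻¹ • A) * NormedSpace.exp ((m : ℝ)⁻¹ • B)) ^ m)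
      atTop (𝓝 (NormedSpace.exp (A + B))) := by
  have hderiv : HasDerivAt
      (fun s : ℝ => NormedSpace.exp (s • A) * NormedSpace.exp (s • B)) (A + B) 0 := by
    simpa using (hasDerivAt_exp_smul_const (𝕂 := ℝ) A (0 : ℝ)).fun_mul
      (hasDerivAt_exp_smul_const (𝕂 := ℝ) B (0 : ℝ))
  exact tendsto_pow_exp (tendsto_smul_sub_one hderiv (by simp))

end LieTrotter

section PoissonPowers

variable {𝔸 : Type*} [NormedRing 𝔸] [NormedAlgebra ℝ 𝔸]

theorem poissonWeight_smul_pow (r : ℝ≥0) (a : 𝔸) (n : ℕ) :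
    (Real.exp (-r) * r ^ n / (n.factorial : ℝ)) • a ^ n =
      Real.exp (-r) • (n.factorial : ℝ)⁻¹ • ((r : ℝ) • a) ^ n := by
  rw [smul_pow, smul_smul, smul_smul]
  congr 1
  ring

theorem integrable_pow_poissonMeasure (r : ℝ≥0) (a : 𝔸) :
    Integrable (fun n => a ^ n) (poissonMeasure r) := by
  rw [integrable_poissonMeasure_iff]
  refine ((NormedSpace.norm_expSeries_summable' (𝕂 := ℝ) ((r : ℝ) • a)).mul_left
    (Real.exp (-r))).congr fun n => ?_
  rw [← norm_smul_of_nonneg (by positivity) (a ^ n), poissonWeight_smul_pow,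
    norm_smul_of_nonneg (Real.exp_nonneg _)]

variable [CompleteSpace 𝔸]

theorem exp_sub_smul_one (a : 𝔸) (r : ℝ) :
    NormedSpace.exp (a - r • 1) = Real.exp (-r) • NormedSpace.exp a := by
  let +nondep : NormedAlgebra ℚ 𝔸 := .restrictScalars ℚ ℝ 𝔸
  have hcomm : Commute (algebraMap ℝ 𝔸 (-r)) a := Algebra.commutes _ _
  rw [sub_eq_neg_add, ← neg_smul, ← Algebra.algebraMap_eq_smul_one,
    NormedSpace.exp_add_of_commute hcomm, ← NormedSpace.algebraMap_exp_comm,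
    ← Real.exp_eq_exp_ℝ, ← Algebra.smul_def]

theorem integral_pow_poissonMeasure (r : ℝ≥0) (a : 𝔸) :
    ∫ n, a ^ n ∂poissonMeasure r = NormedSpace.exp ((r : ℝ) • (a - 1)) := by
  rw [smul_sub, exp_sub_smul_one]
  refine (hasSum_integral_poissonMeasure (integrable_pow_poissonMeasure r a)).unique ?_
  simp only [poissonWeight_smul_pow]
  exact (NormedSpace.exp_series_hasSum_exp' (𝕂 := ℝ) ((r : ℝ) • a)).const_smul _

end PoissonPowers

section RiemannSum

variable {f : ℝ → ℝ} {C : ℝ}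

theorem intervalIntegrable_of_bound (hf : StronglyMeasurable f) (hC : ∀ s, ‖f s‖ ≤ C) (a b : ℝ) :
    IntervalIntegrable f volume a b :=
  ⟨Integrable.of_bound hf.aestronglyMeasurable C (.of_forall hC),
    Integrable.of_bound hf.aestronglyMeasurable C (.of_forall hC)⟩

theorem stronglyMeasurable_comp_floor (hf : StronglyMeasurable f) (h : ℝ) :
    StronglyMeasurable fun s : ℝ => f (⌊s / h⌋₊ * h) :=
  hf.comp_measurable ((measurable_from_nat.comp Nat.measurable_floor).comp
    (measurable_id.div_const h) |>.mul_const h)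

theorem sum_mul_eq_integral_floor (hf : StronglyMeasurable f) (hC : ∀ s, ‖f s‖ ≤ C) {h : ℝ}
    (hh : 0 < h) (m : ℕ) :
    ∑ k ∈ Finset.range m, h * f (k * h) = ∫ s in (0 : ℝ)..m * h, f (⌊s / h⌋₊ * h) := by
  have hcell (k : ℕ) :
      ∫ s in (k * h : ℝ)..((k + 1 : ℕ) * h : ℝ), f (⌊s / h⌋₊ * h) = h * f (k * h) := by
    have hle : (k : ℝ) * h ≤ (k + 1 : ℕ) * h := by gcongr; simp
    rw [intervalIntegral.integral_congr_Ioo_of_le (g := fun _ => f (k * h)) hle fun s hs => ?_]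
    · rw [intervalIntegral.integral_const, smul_eq_mul]
      congr 1
      push_cast
      ring
    · have hfloor : ⌊s / h⌋₊ = k := by
        have hs0 : 0 ≤ s / h := div_nonneg ((by positivity : (0 : ℝ) ≤ k * h).trans hs.1.le) hh.le
        rw [Nat.floor_eq_iff hs0, le_div_iff₀ hh, div_lt_iff₀ hh]
        exact ⟨hs.1.le, by exact_mod_cast hs.2⟩
      simp only [hfloor]
  simp only [← hcell]
  rw [intervalIntegral.sum_integral_adjacent_intervals (a := fun k : ℕ => (k : ℝ) * h) fun k _ =>
    intervalIntegrable_of_bound (stronglyMeasurable_comp_floor hf h) (fun _ => hC _) _ _]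
  simp

theorem tendsto_floor_div_mul {s t : ℝ} (hs : 0 ≤ s) (ht : 0 < t) :
    Tendsto (fun m : ℕ => (⌊s / (t / m)⌋₊ * (t / m) : ℝ)) atTop (𝓝 s) := by
  have hscale : Tendsto (fun m : ℕ => (m : ℝ) / t) atTop atTop :=
    tendsto_natCast_atTop_atTop.atTop_div_const ht
  refine ((tendsto_nat_floor_mul_div_atTop hs).comp hscale).congr fun m => ?_
  rw [Function.comp_apply, ← inv_div (m : ℝ) t, div_inv_eq_mul, ← div_eq_mul_inv]

theorem tendsto_leftRiemannSum (hf : StronglyMeasurable f) (hC : ∀ s, ‖f s‖ ≤ C)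
    (hcont : ∀ᵐ s, ContinuousAt f s) {t : ℝ} (ht : 0 < t) :
    Tendsto (fun m : ℕ => ∑ k ∈ Finset.range m, t / m * f (k * (t / m))) atTop
      (𝓝 (∫ s in (0 : ℝ)..t, f s)) := by
  have hlim : Tendsto (fun m : ℕ => ∫ s in (0 : ℝ)..t, f (⌊s / (t / m)⌋₊ * (t / m))) atTop
      (𝓝 (∫ s in (0 : ℝ)..t, f s)) := by
    refine intervalIntegral.tendsto_integral_filter_of_dominated_convergence (fun _ => C)
      (.of_forall fun m => (stronglyMeasurable_comp_floor hf _).aestronglyMeasurable)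
      (.of_forall fun m => .of_forall fun s _ => hC _) (by simp) ?_
    filter_upwards [hcont] with s hs hmem
    rw [Set.uIoc_of_le ht.le] at hmem
    exact hs.tendsto.comp (tendsto_floor_div_mul hmem.1.le ht)
  refine hlim.congr' ?_
  filter_upwards [eventually_gt_atTop 0] with m hm
  have hm' : (0 : ℝ) < m := by exact_mod_cast hm
  rw [sum_mul_eq_integral_floor hf hC (by positivity), mul_div_cancel₀ t hm'.ne']

end RiemannSum

section SwitchingPath

variable {n : ℝ≥0 → ℕ}

theorem measurable_comp_toNNReal (hn : Monotone n) : Measurable fun s : ℝ => n s.toNNReal :=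
  Monotone.measurable fun _ _ h => hn (Real.toNNReal_mono h)

theorem ae_continuousAt_comp_toNNReal (hn : Monotone n) :
    ∀ᵐ s : ℝ, ContinuousAt (fun s : ℝ => n s.toNNReal) s := by
  have hmono : Monotone fun s : ℝ => n s.toNNReal := fun _ _ h => hn (Real.toNNReal_mono h)
  have hjumps := hmono.countable_not_continuousAt.measure_zero volume
  filter_upwards [measure_eq_zero_iff_ae_notMem.1 hjumps] with s hs
  exact not_not.1 hs

theorem tendsto_leftRiemannSum_path (hn : Monotone n) {ψ : ℕ → ℝ} {C : ℝ} (hC : ∀ k, ‖ψ k‖ ≤ C)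
    {t : ℝ≥0} (ht : 0 < t) :
    Tendsto (fun m : ℕ => ∑ k ∈ Finset.range m, (t / m : ℝ≥0) * ψ (n (k * (t / m)))) atTop
      (𝓝 (∫ s in (0 : ℝ)..t, ψ (n s.toNNReal))) := by
  have hcont : ∀ᵐ s : ℝ, ContinuousAt (fun s : ℝ => ψ (n s.toNNReal)) s := by
    filter_upwards [ae_continuousAt_comp_toNNReal hn] with s hs
    exact (continuous_of_discreteTopology (f := ψ)).continuousAt.comp hs
  have hψ : Measurable ψ := .of_discrete
  refine (tendsto_leftRiemannSum (hψ.comp (measurable_comp_toNNReal hn)).stronglyMeasurable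
    (fun _ => hC _) hcont (NNReal.coe_pos.2 ht)).congr fun m => ?_
  refine Finset.sum_congr rfl fun k _ => ?_
  have htime : (k * (t / m) : ℝ).toNNReal = k * (t / m) := by
    rw [← Real.toNNReal_coe (r := (k * (t / m) : ℝ≥0))]
    push_cast
    rfl
  rw [Function.comp_apply, htime, NNReal.coe_div, NNReal.coe_natCast]

end SwitchingPath

section FeynmanKac

open scoped Matrix.Norms.Operator

variable {Ω S : Type*}

/-- The number of events of the counting process `N` in the `i`-th cell of the grid of mesh `h`. -/
def gridIncrement (N : ℝ≥0 → Ω → ℕ) (h : ℝ≥0) (i : ℕ) (ω : Ω) : ℕ :=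
  N ((i + 1 : ℕ) * h) ω - N (i * h) ω

theorem monotone_natCast_mul (h : ℝ≥0) : Monotone fun i : ℕ => (i : ℝ≥0) * h :=
  fun _ _ hij => mul_le_mul_left (Nat.cast_le.2 hij) h

theorem sum_gridIncrement {N : ℝ≥0 → Ω → ℕ} {ω : Ω} (hzero : N 0 ω = 0)
    (hmono : Monotone fun t => N t ω) (h : ℝ≥0) (k : ℕ) :
    ∑ i ∈ Finset.range k, gridIncrement N h i ω = N (k * h) ω := by
  have htelescope := Finset.sum_range_tsub (hmono.comp (monotone_natCast_mul h)) k
  simpa [gridIncrement, Function.comp_def, hzero] using htelescope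

theorem map_integral_pow_poissonMeasure [Fintype S] [DecidableEq S] (Q : Matrix S S ℝ)
    (r : ℝ≥0) :
    (Matrix.of fun i j => ∫ n, (Q ^ n) i j ∂poissonMeasure r).map (algebraMap ℝ ℂ) =
      NormedSpace.exp ((r : ℝ) • (Q.map (algebraMap ℝ ℂ) - 1)) := by
  have hpow (i j : S) (n : ℕ) : ((Q ^ n) i j : ℂ) = (Q.map (algebraMap ℝ ℂ) ^ n) i j := by
    rw [← Matrix.map_pow]
    rfl
  refine Eq.trans ?_ (integral_pow_poissonMeasure r _)
  ext i j
  have hentry := (Matrix.entryLinearMap ℝ ℂ i j).toContinuousLinearMap.integral_comp_comm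
    (integrable_pow_poissonMeasure r (Q.map (algebraMap ℝ ℂ)))
  calc ((∫ n, (Q ^ n) i j ∂poissonMeasure r : ℝ) : ℂ)
    _ = ∫ n, ((Q ^ n) i j : ℂ) ∂poissonMeasure r := integral_complex_ofReal.symm
    _ = ∫ n, (Q.map (algebraMap ℝ ℂ) ^ n) i j ∂poissonMeasure r := by simp only [hpow]
    _ = _ := hentry

namespace IsPoissonProcess

variable [MeasurableSpace Ω] {P : Measure Ω} {N : ℝ≥0 → Ω → ℕ} {lam : ℝ}

theorem measurable_gridIncrement (hN : IsPoissonProcess N lam P) (h : ℝ≥0) (i : ℕ) :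
    Measurable (gridIncrement N h i) :=
  (hN.measurable _).sub (hN.measurable _)

theorem hasLaw_gridIncrement (hN : IsPoissonProcess N lam P) (h : ℝ≥0) (i : ℕ) :
    HasLaw (gridIncrement N h i) (poissonMeasure (lam.toNNReal * h)) P := by
  have hmesh : ((i + 1 : ℕ) * h - i * h : ℝ≥0) = h := by
    rw [Nat.cast_succ, add_mul, one_mul, add_tsub_cancel_left]
  have hlaw := hN.law_increment (i * h) ((i + 1 : ℕ) * h) (monotone_natCast_mul h i.le_succ)
  rwa [hmesh] at hlaw

variable [MeasurableSpace S] {X : ℕ → Ω → S} {π : S → ℝ} {Q : Matrix S S ℝ}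

theorem measurable_comp (hN : IsPoissonProcess N lam P) (hX : IsMarkovChain X π Q P) (t : ℝ≥0) :
    Measurable fun ω => X (N t ω) ω :=
  measurable_snd_apply_fst.comp ((hN.measurable t).prodMk (measurable_pi_lambda _ hX.measurable))

section Finite

variable [Finite S] [MeasurableSingletonClass S]

theorem measurable_leftRiemannSum (hN : IsPoissonProcess N lam P) (hX : IsMarkovChain X π Q P)
    (b : S → ℝ) (h : ℝ≥0) (m : ℕ) :
    Measurable fun ω => ∑ k ∈ Finset.range m, h * b (X (N (k * h) ω) ω) :=
  Finset.measurable_sum _ fun _ _ =>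
    ((Measurable.of_discrete (f := b)).comp (hN.measurable_comp hX _)).const_mul _

theorem aemeasurable_integral (hN : IsPoissonProcess N lam P) (hX : IsMarkovChain X π Q P)
    (b : S → ℝ) {t : ℝ≥0} (ht : 0 < t) :
    AEMeasurable (fun ω => ∫ s in (0 : ℝ)..t, b (X (N s.toNNReal ω) ω)) P := by
  refine aemeasurable_of_tendsto_metrizable_ae atTop
    (fun m : ℕ => (hN.measurable_leftRiemannSum hX b (t / m) m).aemeasurable) ?_
  filter_upwards [hN.monotone] with ω hmono
  have := Fintype.ofFinite S
  exact tendsto_leftRiemannSum_path hmono (fun k => norm_le_pi_norm b (X k ω)) ht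

end Finite

variable [Fintype S] [MeasurableSingletonClass S] [DecidableEq S]

theorem isMarkovChain_grid [IsFiniteMeasure P] (hN : IsPoissonProcess N lam P)
    (hX : IsMarkovChain X π Q P) (hNX : IndepFun (fun ω t => N t ω) (fun ω n => X n ω) P)
    (h : ℝ≥0) :
    IsMarkovChain (fun k ω => X (∑ i ∈ Finset.range k, gridIncrement N h i ω) ω) π
      (Matrix.of fun i j => ∫ n, (Q ^ n) i j ∂poissonMeasure (lam.toNNReal * h)) P :=
  hX.comp_sum (hN.measurable_gridIncrement h) (hN.hasLaw_gridIncrement h)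
    (hN.indepIncrements.nat (monotone_natCast_mul h))
    (hNX.comp (φ := fun f (i : ℕ) => f ((i + 1 : ℕ) * h) - f (i * h))
      (measurable_pi_lambda _ fun i => by fun_prop) measurable_id)

theorem integral_exp_leftRiemannSum [IsProbabilityMeasure P] (hlam : 0 ≤ lam)
    (hN : IsPoissonProcess N lam P) (hX : IsMarkovChain X π Q P)
    (hNX : IndepFun (fun ω t => N t ω) (fun ω n => X n ω) P) (b : S → ℝ) (h : ℝ≥0) (m : ℕ) :
    ∫ ω, Complex.exp (Complex.I * (∑ k ∈ Finset.range m, h * b (X (N (k * h) ω) ω) : ℝ)) ∂P =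
      (fun i => (π i : ℂ)) ⬝ᵥ
        ((NormedSpace.exp ((h : ℝ) • Matrix.diagonal fun i => Complex.I * b i) *
          NormedSpace.exp ((h : ℝ) • lam • (Q.map (algebraMap ℝ ℂ) - 1))) ^ m).mulVec 1 := by
  have hdiag : NormedSpace.exp ((h : ℝ) • Matrix.diagonal fun i => Complex.I * b i) =
      Matrix.diagonal fun i => Complex.exp (Complex.I * (h * b i : ℝ)) := by
    rw [← Matrix.diagonal_smul, Matrix.exp_diagonal]
    congr 1 with i
    rw [Pi.coe_exp, Complex.exp_eq_exp_ℂ]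
    simp [mul_left_comm]
  have hgrid := (hN.isMarkovChain_grid hX hNX h).integral_prod_mul
    (fun i => Complex.exp (Complex.I * (h * b i : ℝ))) 1 m
  rw [map_integral_pow_poissonMeasure, NNReal.coe_mul, Real.coe_toNNReal _ hlam, mul_comm,
    mul_smul, ← hdiag] at hgrid
  refine Eq.trans (integral_congr_ae ?_) hgrid
  filter_upwards [hN.monotone, hN.zero] with ω hmono hzero
  simp only [sum_gridIncrement hzero hmono, Pi.one_apply, mul_one, Complex.ofReal_sum,
    Finset.mul_sum, Complex.exp_sum]

theorem integral_exp_integral [IsProbabilityMeasure P] [Nonempty S] (hlam : 0 ≤ lam)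
    (hN : IsPoissonProcess N lam P) (hX : IsMarkovChain X π Q P)
    (hNX : IndepFun (fun ω t => N t ω) (fun ω n => X n ω) P) (b : S → ℝ) {t : ℝ≥0} (ht : 0 < t) :
    ∫ ω, Complex.exp (Complex.I * (∫ s in (0 : ℝ)..t, b (X (N s.toNNReal ω) ω) : ℝ)) ∂P =
      (fun i => (π i : ℂ)) ⬝ᵥ
        (NormedSpace.exp ((t : ℝ) • ((Matrix.diagonal fun i => Complex.I * b i) +
          lam • (Q.map (algebraMap ℝ ℂ) - 1)))).mulVec 1 := by
  have hexp : Continuous fun x : ℝ => Complex.exp (Complex.I * x) := by fun_prop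
  have hintegral : Tendsto (fun m : ℕ => ∫ ω, Complex.exp (Complex.I *
        (∑ k ∈ Finset.range m, (t / m : ℝ≥0) * b (X (N (k * (t / m)) ω) ω) : ℝ)) ∂P) atTop
      (𝓝 (∫ ω, Complex.exp (Complex.I *
        (∫ s in (0 : ℝ)..t, b (X (N s.toNNReal ω) ω) : ℝ)) ∂P)) := by
    refine tendsto_integral_of_dominated_convergence (fun _ => 1) (fun m => ?_)
      (integrable_const 1) (fun m => .of_forall fun ω => ?_) ?_
    · exact (hexp.measurable.comp (measurable_leftRiemannSum hN hX b _ m)).aestronglyMeasurable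
    · rw [Complex.norm_exp_I_mul_ofReal]
    · filter_upwards [hN.monotone] with ω hmono
      exact (hexp.tendsto _).comp
        (tendsto_leftRiemannSum_path hmono (fun k => norm_le_pi_norm b (X k ω)) ht)
  have hmatrix := tendsto_exp_mul_exp_pow ((t : ℝ) • Matrix.diagonal fun i => Complex.I * (b i : ℂ))
    ((t : ℝ) • lam • (Q.map (algebraMap ℝ ℂ) - 1))
  rw [← smul_add] at hmatrix
  have hbilin : Continuous fun A : Matrix S S ℂ => (fun i => (π i : ℂ)) ⬝ᵥ A.mulVec 1 := by
    fun_prop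
  refine tendsto_nhds_unique hintegral (((hbilin.tendsto _).comp hmatrix).congr fun m => ?_)
  have hmesh : ((t / m : ℝ≥0) : ℝ) = (m : ℝ)⁻¹ * t := by
    rw [NNReal.coe_div, NNReal.coe_natCast, div_eq_inv_mul]
  rw [hN.integral_exp_leftRiemannSum hlam hX hNX, hmesh, mul_smul, mul_smul (m : ℝ)⁻¹]
  rfl

end IsPoissonProcess

end FeynmanKac

section HyperbolicSeries

/-- The entire function `κ ↦ cosh (√κ t)`, defined by its series so that `κ` may be negative. -/
noncomputable def coshSqrt (κ t : ℝ) : ℝ :=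
  ∑' n : ℕ, κ ^ n * t ^ (2 * n) / ((2 * n).factorial : ℝ)

/-- The entire function `κ ↦ sinh (√κ t) / √κ`, defined by its series so that `κ` may be zero or
negative. -/
noncomputable def sinhSqrt (κ t : ℝ) : ℝ :=
  ∑' n : ℕ, κ ^ n * t ^ (2 * n + 1) / ((2 * n + 1).factorial : ℝ)

theorem norm_pow_mul_pow (κ t : ℝ) (n k : ℕ) :
    ‖κ ^ n * t ^ (2 * n + k)‖ = (Real.sqrt |κ| * |t|) ^ (2 * n) * |t| ^ k := by
  rw [norm_mul, norm_pow, norm_pow, Real.norm_eq_abs, Real.norm_eq_abs, mul_pow, pow_mul,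
    Real.sq_sqrt (abs_nonneg κ), pow_add, mul_assoc]

theorem hasSum_coshSqrt (κ t : ℝ) :
    HasSum (fun n : ℕ => κ ^ n * t ^ (2 * n) / ((2 * n).factorial : ℝ)) (coshSqrt κ t) := by
  refine Summable.hasSum (Summable.of_norm_bounded
    ((Real.summable_pow_div_factorial (Real.sqrt |κ| * |t|)).comp_injective
      (mul_right_injective₀ two_ne_zero)) fun n => ?_)
  rw [norm_div, RCLike.norm_natCast]
  exact div_le_div_of_nonneg_right (by simpa using (norm_pow_mul_pow κ t n 0).le) (by positivity)

theorem hasSum_sinhSqrt (κ t : ℝ) :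
    HasSum (fun n : ℕ => κ ^ n * t ^ (2 * n + 1) / ((2 * n + 1).factorial : ℝ))
      (sinhSqrt κ t) := by
  refine Summable.hasSum (Summable.of_norm_bounded
    (((Real.summable_pow_div_factorial (Real.sqrt |κ| * |t|)).comp_injective
      (mul_right_injective₀ two_ne_zero)).mul_right |t|) fun n => ?_)
  rw [norm_div, RCLike.norm_natCast, Function.comp_apply, div_mul_eq_mul_div, norm_pow_mul_pow,
    pow_one]
  gcongr
  exact Nat.le_succ _

theorem exp_smul_of_mul_self_eq_smul_one {𝔸 : Type*} [NormedRing 𝔸] [NormedAlgebra ℝ 𝔸]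
    [CompleteSpace 𝔸] {Z : 𝔸} {κ : ℝ} (hZ : Z * Z = κ • 1) (t : ℝ) :
    NormedSpace.exp (t • Z) = coshSqrt κ t • 1 + sinhSqrt κ t • Z := by
  let +nondep : NormedAlgebra ℚ 𝔸 := .restrictScalars ℚ ℝ 𝔸
  have heven (n : ℕ) : Z ^ (2 * n) = κ ^ n • 1 := by rw [pow_mul, sq, hZ, smul_pow, one_pow]
  have hodd (n : ℕ) : Z ^ (2 * n + 1) = κ ^ n • Z := by rw [pow_succ, heven, smul_one_mul]
  refine (NormedSpace.exp_series_hasSum_exp' (𝕂 := ℝ) (t • Z)).unique (HasSum.even_add_odd ?_ ?_)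
  · convert (hasSum_coshSqrt κ t).smul_const (1 : 𝔸) using 2 with n
    rw [smul_pow, heven, smul_smul, smul_smul]
    congr 1
    ring
  · convert (hasSum_sinhSqrt κ t).smul_const Z using 2 with n
    rw [smul_pow, hodd, smul_smul, smul_smul]
    congr 1
    ring

theorem coshSqrt_sq_mul (c κ t : ℝ) : coshSqrt (c ^ 2 * κ) t = coshSqrt κ (c * t) :=
  (hasSum_coshSqrt (c ^ 2 * κ) t).unique <|
    (hasSum_coshSqrt κ (c * t)).congr_fun fun n => by ring

theorem mul_sinhSqrt_sq_mul (c κ t : ℝ) : c * sinhSqrt (c ^ 2 * κ) t = sinhSqrt κ (c * t) :=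
  ((hasSum_sinhSqrt (c ^ 2 * κ) t).mul_left c).unique <|
    (hasSum_sinhSqrt κ (c * t)).congr_fun fun n => by ring

end HyperbolicSeries

/-- The characteristic function, at the frequency `α`, of the position at time `t` of the symmetric
telegraph process with unit speed and rate of reversal `μ`. -/
noncomputable def telegraphChar (μ α t : ℝ) : ℝ :=
  Real.exp (-(μ * t)) *
    (coshSqrt (μ ^ 2 - α ^ 2) t + μ * sinhSqrt (μ ^ 2 - α ^ 2) t)

theorem telegraphChar_mul_mul (c μ α t : ℝ) :
    telegraphChar (c * μ) (c * α) t = telegraphChar μ α (c * t) := by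
  rw [telegraphChar, telegraphChar, ← coshSqrt_sq_mul, ← mul_sinhSqrt_sq_mul, mul_pow, mul_pow,
    ← mul_sub]
  ring_nf

section Generator

open scoped Matrix.Norms.Operator

/-- The sign of the velocity `X' + Y'` along the direction `d_j`. -/
def signU : Fin 4 → ℝ := ![1, 1, -1, -1]

/-- The sign of the velocity `X' - Y'` along the direction `d_j`. -/
def signV : Fin 4 → ℝ := ![1, -1, -1, 1]

/-- The part of the generator that governs `X + Y`: its velocity is tracked at the frequency `α`,
and the turns that reverse it occur at the rate `μ`. -/
noncomputable def sumGenerator (α μ : ℝ) : Matrix (Fin 4) (Fin 4) ℂ :=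
  !![Complex.I * α, 0, 0, μ; 0, Complex.I * α, μ, 0;
    0, μ, -(Complex.I * α), 0; μ, 0, 0, -(Complex.I * α)]

/-- The part of the generator that governs `X - Y`: its velocity is tracked at the frequency `β`,
and the turns that reverse it occur at the rate `ν`. -/
noncomputable def diffGenerator (β ν : ℝ) : Matrix (Fin 4) (Fin 4) ℂ :=
  !![Complex.I * β, ν, 0, 0; ν, -(Complex.I * β), 0, 0;
    0, 0, -(Complex.I * β), ν; 0, 0, ν, Complex.I * β]

theorem sumGenerator_mul_self (α μ : ℝ) :
    sumGenerator α μ * sumGenerator α μ = (μ ^ 2 - α ^ 2) • 1 := by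
  ext i j
  fin_cases i <;> fin_cases j <;> simp [sumGenerator, Matrix.mul_apply, Fin.sum_univ_four] <;>
    ring_nf <;> simp <;> ring

theorem diffGenerator_mul_self (β ν : ℝ) :
    diffGenerator β ν * diffGenerator β ν = (ν ^ 2 - β ^ 2) • 1 := by
  ext i j
  fin_cases i <;> fin_cases j <;> simp [diffGenerator, Matrix.mul_apply, Fin.sum_univ_four] <;>
    ring_nf <;> simp <;> ring

theorem commute_sumGenerator_diffGenerator (α μ β ν : ℝ) :
    Commute (sumGenerator α μ) (diffGenerator β ν) := by
  ext i j
  fin_cases i <;> fin_cases j <;>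
    simp [sumGenerator, diffGenerator, Matrix.mul_apply, Fin.sum_univ_four] <;> ring

theorem of_turnProb (p : ℝ) : Matrix.of (turnProb p) =
    !![0, p, 0, 1 - p; p, 0, 1 - p, 0; 0, 1 - p, 0, p; 1 - p, 0, p, 0] := by
  have h : (-1 : Fin 4) = 3 := rfl
  ext i j
  fin_cases i <;> fin_cases j <;> simp [turnProb, h]

theorem diagonal_add_turn_generator (lam p α β : ℝ) :
    (Matrix.diagonal fun j => Complex.I * ((α * signU j + β * signV j : ℝ) : ℂ)) +
        lam • ((Matrix.of (turnProb p)).map (algebraMap ℝ ℂ) - 1) =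
      sumGenerator α (lam * (1 - p)) + diffGenerator β (lam * p) - lam • 1 := by
  rw [of_turnProb]
  ext i j
  fin_cases i <;> fin_cases j <;> simp [sumGenerator, diffGenerator, signU, signV] <;> ring

theorem exp_smul_generator (α μ β ν t : ℝ) :
    NormedSpace.exp (t • (sumGenerator α μ + diffGenerator β ν - (μ + ν) • 1)) =
      Real.exp (-((μ + ν) * t)) •
        ((coshSqrt (μ ^ 2 - α ^ 2) t • 1 + sinhSqrt (μ ^ 2 - α ^ 2) t • sumGenerator α μ) *
          (coshSqrt (ν ^ 2 - β ^ 2) t • 1 + sinhSqrt (ν ^ 2 - β ^ 2) t • diffGenerator β ν)) := by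
  have hcomm := ((commute_sumGenerator_diffGenerator α μ β ν).smul_left t).smul_right t
  refine Eq.trans ?_ ((exp_sub_smul_one (t • (sumGenerator α μ + diffGenerator β ν))
    ((μ + ν) * t)).trans ?_)
  · rw [smul_sub, smul_smul, mul_comm t]
    rfl
  · rw [smul_add, NormedSpace.exp_add_of_commute hcomm,
      exp_smul_of_mul_self_eq_smul_one (sumGenerator_mul_self α μ),
      exp_smul_of_mul_self_eq_smul_one (diffGenerator_mul_self β ν)]

theorem dotProduct_exp_smul_generator_mulVec_one (α μ β ν t : ℝ) :
    (fun _ : Fin 4 => (1 / 4 : ℂ)) ⬝ᵥ (NormedSpace.exp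
        (t • (sumGenerator α μ + diffGenerator β ν - (μ + ν) • 1))).mulVec 1 =
      telegraphChar μ α t * telegraphChar ν β t := by
  have hexp : Real.exp (-((μ + ν) * t)) = Real.exp (-(μ * t)) * Real.exp (-(ν * t)) := by
    rw [← Real.exp_add]
    ring_nf
  rw [exp_smul_generator, hexp]
  simp only [telegraphChar, Complex.ofReal_mul, Complex.ofReal_add]
  simp [sumGenerator, diffGenerator, dotProduct, Matrix.mulVec, Matrix.mul_apply,
    Fin.sum_univ_four]
  ring

end Generator

section Mechanism

variable {Ω : Type*} [MeasurableSpace Ω] {P : Measure Ω}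

theorem IsDirectionChain.isMarkovChain {ξ : ℕ → Ω → Fin 4} {p : ℝ} (hξ : IsDirectionChain ξ p P) :
    IsMarkovChain ξ (fun _ => 1 / 4) (Matrix.of (turnProb p)) P :=
  ⟨hξ.measurable, hξ.law_path⟩

theorem IsDirectionMechanism.integral_exp_integral [IsProbabilityMeasure P]
    {N : ℝ≥0 → Ω → ℕ} {ξ : ℕ → Ω → Fin 4} {lam p : ℝ} (hlam : 0 ≤ lam)
    (hmech : IsDirectionMechanism N ξ lam p P) {t : ℝ≥0} (ht : 0 < t) (α β : ℝ) :
    ∫ ω, Complex.exp (Complex.I * (∫ s in (0 : ℝ)..t,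
        (α * signU (direction N ξ s.toNNReal ω) + β * signV (direction N ξ s.toNNReal ω)) : ℝ)) ∂P =
      telegraphChar (lam * (1 - p)) α t * telegraphChar (lam * p) β t := by
  have hFK := hmech.poisson.integral_exp_integral hlam hmech.chain.isMarkovChain hmech.indep
    (fun j => α * signU j + β * signV j) ht
  have hrates : lam = lam * (1 - p) + lam * p := by ring
  have hsplit := dotProduct_exp_smul_generator_mulVec_one α (lam * (1 - p)) β (lam * p) t
  rw [← hrates] at hsplit
  rw [diagonal_add_turn_generator] at hFK
  refine hFK.trans (Eq.trans ?_ hsplit)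
  simp

end Mechanism

section BesselClifford

/-- The Bessel–Clifford function `C_n`, the entire function with `I_n(x) = (x / 2)^n C_n(x² / 4)`.
It turns the Bessel functions of a square root into smooth functions of the radicand. -/
noncomputable def besselClifford (n : ℕ) (z : ℝ) : ℝ :=
  ∑' k : ℕ, z ^ k / ((k.factorial : ℝ) * (k + n).factorial)

theorem norm_div_factorial_mul_factorial_le (n k : ℕ) (x : ℝ) :
    ‖x / ((k.factorial : ℝ) * (k + n).factorial)‖ ≤ ‖x‖ / k.factorial := by
  rw [norm_div, norm_mul, RCLike.norm_natCast, RCLike.norm_natCast]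
  refine div_le_div_of_nonneg_left (norm_nonneg x) (by positivity)
    (le_mul_of_one_le_right (by positivity) ?_)
  exact_mod_cast (k + n).factorial_pos

theorem hasSum_besselClifford (n : ℕ) (z : ℝ) :
    HasSum (fun k : ℕ => z ^ k / ((k.factorial : ℝ) * (k + n).factorial)) (besselClifford n z) :=
  (Summable.of_norm_bounded (Real.summable_pow_div_factorial ‖z‖) fun k => by
    simpa only [norm_pow] using norm_div_factorial_mul_factorial_le n k (z ^ k)).hasSum

theorem besselClifford_nonneg (n : ℕ) {z : ℝ} (hz : 0 ≤ z) : 0 ≤ besselClifford n z :=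
  tsum_nonneg fun k => by positivity

theorem hasDerivAt_besselClifford (n : ℕ) (z : ℝ) :
    HasDerivAt (besselClifford n) (besselClifford (n + 1) z) z := by
  have htail (y : ℝ) : HasSum
      (fun k : ℕ => y ^ (k + 1) / (((k + 1).factorial : ℝ) * (k + 1 + n).factorial))
      (besselClifford n y - 1 / n.factorial) := by
    simpa using (hasSum_nat_add_iff' 1).2 (hasSum_besselClifford n y)
  have hterm (k : ℕ) (y : ℝ) : HasDerivAt
      (fun y : ℝ => y ^ (k + 1) / (((k + 1).factorial : ℝ) * (k + 1 + n).factorial))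
      (y ^ k / ((k.factorial : ℝ) * (k + (n + 1)).factorial)) y := by
    refine ((hasDerivAt_pow (k + 1) y).div_const _).congr_deriv ?_
    rw [Nat.factorial_succ k, add_right_comm k 1 n, add_assoc k n 1]
    push_cast
    field_simp
  have hz : z ∈ Metric.ball 0 (‖z‖ + 1) := by simp
  have hderiv := hasDerivAt_tsum_of_isPreconnected
    (Real.summable_pow_div_factorial (‖z‖ + 1)) Metric.isOpen_ball
    (convex_ball (0 : ℝ) (‖z‖ + 1)).isPreconnected (fun k y _ => hterm k y)
    (fun k y hy => (norm_div_factorial_mul_factorial_le (n + 1) k (y ^ k)).trans ?_)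
    hz (htail z).summable hz
  · refine (hderiv.add_const (1 / (n.factorial : ℝ))).congr_of_eventuallyEq
      (Eventually.of_forall fun y => ?_)
    simp only [(htail y).tsum_eq, sub_add_cancel]
  · rw [norm_pow]
    gcongr
    exact (mem_ball_zero_iff.1 hy).le

theorem continuous_besselClifford (n : ℕ) : Continuous (besselClifford n) :=
  continuous_iff_continuousAt.2 fun z => (hasDerivAt_besselClifford n z).continuousAt

theorem besselI0_mul_sqrt (m : ℝ) {y : ℝ} (hy : 0 ≤ y) :
    besselI0 (m * Real.sqrt y) = besselClifford 0 (m ^ 2 / 4 * y) := by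
  refine tsum_congr fun k => ?_
  rw [pow_mul, div_pow, mul_pow, Real.sq_sqrt hy, add_zero, ← sq]
  ring

theorem hasDerivAt_besselI0_sqrt (m c : ℝ) {w t : ℝ} (h : 0 < c ^ 2 * t ^ 2 - w ^ 2) :
    HasDerivAt (fun s => besselI0 (m * Real.sqrt (c ^ 2 * s ^ 2 - w ^ 2)))
      (besselClifford 1 (m ^ 2 / 4 * (c ^ 2 * t ^ 2 - w ^ 2)) *
        (m ^ 2 / 4 * (c ^ 2 * (2 * t)))) t := by
  have hquad : HasDerivAt (fun s : ℝ => m ^ 2 / 4 * (c ^ 2 * s ^ 2 - w ^ 2))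
      (m ^ 2 / 4 * (c ^ 2 * (2 * t))) t := by
    simpa using (((hasDerivAt_pow 2 t).const_mul (c ^ 2)).sub_const (w ^ 2)).const_mul (m ^ 2 / 4)
  have hcont : Continuous fun s : ℝ => c ^ 2 * s ^ 2 - w ^ 2 := by fun_prop
  refine ((hasDerivAt_besselClifford 0 _).comp t hquad).congr_of_eventuallyEq ?_
  filter_upwards [hcont.continuousAt.eventually (lt_mem_nhds h)] with s hs
  exact besselI0_mul_sqrt m hs.le

end BesselClifford

section CosineTransform

theorem integral_even_pow_mul_sub_sq_pow_succ (a : ℝ) (j k : ℕ) :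
    ∫ u in (-a)..a, u ^ (2 * j) * (a ^ 2 - u ^ 2) ^ (k + 1) =
      2 * (k + 1) / (2 * j + 1) * ∫ u in (-a)..a, u ^ (2 * (j + 1)) * (a ^ 2 - u ^ 2) ^ k := by
  have hu (x : ℝ) : HasDerivAt (fun u : ℝ => (a ^ 2 - u ^ 2) ^ (k + 1))
      ((k + 1) * (a ^ 2 - x ^ 2) ^ k * -(2 * x)) x := by
    refine (((hasDerivAt_pow 2 x).const_sub (a ^ 2)).pow (k + 1)).congr_deriv ?_
    simp
  have hv (x : ℝ) : HasDerivAt (fun u : ℝ => u ^ (2 * j + 1) / (2 * j + 1)) (x ^ (2 * j)) x := by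
    refine ((hasDerivAt_pow (2 * j + 1) x).div_const (2 * (j : ℝ) + 1)).congr_deriv ?_
    push_cast
    field_simp
  have hparts := intervalIntegral.integral_mul_deriv_eq_deriv_mul (a := -a) (b := a)
    (fun x _ => hu x) (fun x _ => hv x) (Continuous.intervalIntegrable (by fun_prop) _ _)
    (Continuous.intervalIntegrable (by fun_prop) _ _)
  simp only [mul_comm (_ ^ (2 * j))]
  rw [hparts, ← intervalIntegral.integral_const_mul]
  simp only [neg_sq, sub_self, ne_eq, Nat.add_one_ne_zero, not_false_eq_true, zero_pow, zero_mul,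
    zero_sub, ← intervalIntegral.integral_neg]
  refine intervalIntegral.integral_congr fun u _ => ?_
  ring

theorem integral_even_pow_mul_sub_sq_pow (a : ℝ) (j k : ℕ) :
    ∫ u in (-a)..a, u ^ (2 * j) * (a ^ 2 - u ^ 2) ^ k =
      2 * 4 ^ k * (j + k).choose k * (k.factorial ^ 2 * (2 * j).factorial) *
        (a ^ (2 * (j + k) + 1) / (2 * (j + k) + 1).factorial) := by
  induction k generalizing j with
  | zero =>
    simp only [pow_zero, mul_one, integral_pow, (odd_two_mul_add_one j).neg_pow a, add_zero,
      Nat.choose_zero_right, Nat.factorial_zero, Nat.factorial_succ (2 * j)]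
    push_cast
    field_simp
    ring
  | succ k ih =>
    have hchoose : ((j + 1 : ℕ) : ℝ) * (j + (k + 1)).choose k =
        (k + 1 : ℕ) * (j + (k + 1)).choose (k + 1) := by
      have := Nat.choose_succ_right_eq (j + (k + 1)) k
      rw [show j + (k + 1) - k = j + 1 by omega] at this
      exact_mod_cast (by linarith)
    rw [integral_even_pow_mul_sub_sq_pow_succ, ih, show j + 1 + k = j + (k + 1) by ring,
      show 2 * (j + 1) = 2 * j + 1 + 1 by ring, Nat.factorial_succ (2 * j + 1),
      Nat.factorial_succ (2 * j), Nat.factorial_succ k]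
    push_cast at hchoose ⊢
    field_simp
    linear_combination (4 * 4 ^ k * a ^ (2 * (j + (k + 1)) + 1) : ℝ) * hchoose

theorem abs_sq_sub_sq_le {a u : ℝ} (hu : |u| ≤ a) : |a ^ 2 - u ^ 2| ≤ a ^ 2 := by
  have := sq_le_sq' (abs_le.1 hu).1 (abs_le.1 hu).2
  exact abs_le.2 ⟨by nlinarith, by nlinarith [sq_nonneg u]⟩

theorem hasSum_prod_integral_cos_mul {a : ℝ} (ha : 0 ≤ a) (α : ℝ) {b : ℕ → ℝ}
    (hb : Summable fun k => |b k| * (a ^ 2) ^ k) :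
    HasSum (fun x : ℕ × ℕ => (-1) ^ x.1 * α ^ (2 * x.1) / (2 * x.1).factorial * b x.2 *
        ∫ u in (-a)..a, u ^ (2 * x.1) * (a ^ 2 - u ^ 2) ^ x.2)
      (∫ u in (-a)..a, Real.cos (α * u) * ∑' k, b k * (a ^ 2 - u ^ 2) ^ k) := by
  have hbound : Summable fun x : ℕ × ℕ =>
      (|α| * a) ^ (2 * x.1) / (2 * x.1).factorial * (|b x.2| * (a ^ 2) ^ x.2) :=
    (Real.hasSum_cosh (|α| * a)).summable.mul_of_nonneg hb (fun j => by positivity)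
      fun k => by positivity
  have habs {u : ℝ} (hu : u ∈ Set.uIoc (-a) a) : |u| ≤ a := by
    rw [Set.uIoc_of_le (by linarith)] at hu
    exact abs_le.2 ⟨hu.1.le, hu.2⟩
  have hterm {u : ℝ} (hu : u ∈ Set.uIoc (-a) a) (x : ℕ × ℕ) :
      ‖(-1) ^ x.1 * (α * u) ^ (2 * x.1) / (2 * x.1).factorial * (b x.2 * (a ^ 2 - u ^ 2) ^ x.2)‖ ≤
        (|α| * a) ^ (2 * x.1) / (2 * x.1).factorial * (|b x.2| * (a ^ 2) ^ x.2) := by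
    simp only [norm_mul, norm_div, norm_pow, norm_neg, norm_one, one_pow, one_mul,
      RCLike.norm_natCast, Real.norm_eq_abs]
    gcongr
    exacts [habs hu, abs_sq_sub_sq_le (habs hu)]
  have hsum {u : ℝ} (hu : u ∈ Set.uIoc (-a) a) : HasSum
      (fun x : ℕ × ℕ =>
        (-1) ^ x.1 * (α * u) ^ (2 * x.1) / (2 * x.1).factorial * (b x.2 * (a ^ 2 - u ^ 2) ^ x.2))
      (Real.cos (α * u) * ∑' k, b k * (a ^ 2 - u ^ 2) ^ k) := by
    refine (Real.hasSum_cos (α * u)).mul (Summable.hasSum (.of_norm_bounded hb fun k => ?_))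
      (.of_norm_bounded hbound (hterm hu))
    rw [norm_mul, norm_pow, Real.norm_eq_abs, Real.norm_eq_abs]
    gcongr
    exact abs_sq_sub_sq_le (habs hu)
  refine (intervalIntegral.hasSum_integral_of_dominated_convergence _
    (fun x => Continuous.aestronglyMeasurable (by fun_prop))
    (fun x => ae_of_all _ fun u hu => hterm hu x) (ae_of_all _ fun _ _ => hbound) (by simp)
    (ae_of_all _ fun u hu => hsum hu)).congr_fun fun x => ?_
  rw [← intervalIntegral.integral_const_mul]
  refine intervalIntegral.integral_congr fun u _ => ?_
  rw [mul_pow]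
  ring

theorem hasSum_integral_cos_mul {a : ℝ} (ha : 0 ≤ a) (α : ℝ) {b : ℕ → ℝ}
    (hb : Summable fun k => |b k / k.factorial ^ 2| * (a ^ 2) ^ k) :
    HasSum (fun n => 2 * (∑ x ∈ Finset.HasAntidiagonal.antidiagonal n,
        n.choose x.2 * (-α ^ 2) ^ x.1 * (4 ^ x.2 * b x.2)) *
          (a ^ (2 * n + 1) / (2 * n + 1).factorial))
      (∫ u in (-a)..a, Real.cos (α * u) * ∑' k, b k / k.factorial ^ 2 * (a ^ 2 - u ^ 2) ^ k) := by
  have hpairs := hasSum_prod_integral_cos_mul ha α hb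
  rw [← Finset.HasAntidiagonal.sigmaAntidiagonalEquivProd.hasSum_iff] at hpairs
  refine hpairs.sigma fun n => ?_
  rw [Finset.mul_sum, Finset.sum_mul, ← Finset.sum_coe_sort]
  refine (hasSum_fintype _).congr_fun fun x => ?_
  obtain ⟨⟨j, k⟩, hx⟩ := x
  obtain rfl := Finset.HasAntidiagonal.mem_antidiagonal.1 hx
  simp only [Function.comp_apply, Finset.HasAntidiagonal.sigmaAntidiagonalEquivProd_apply,
    integral_even_pow_mul_sub_sq_pow]
  rw [neg_pow (α ^ 2), ← pow_mul]
  field_simp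

end CosineTransform

section BesselTransform

theorem add_pow_eq_sum_antidiagonal (x y : ℝ) (n : ℕ) :
    (x + y) ^ n = ∑ k ∈ Finset.HasAntidiagonal.antidiagonal n,
      n.choose k.2 * x ^ k.1 * y ^ k.2 := by
  rw [(Commute.all x y).add_pow']
  refine Finset.sum_congr rfl fun k hk => ?_
  rw [nsmul_eq_mul, mul_assoc,
    Nat.choose_symm_of_eq_add (Finset.HasAntidiagonal.mem_antidiagonal.1 hk).symm]

theorem mul_sum_antidiagonal_choose_mul_pow_div (x y : ℝ) (n : ℕ) :
    y * ∑ k ∈ Finset.HasAntidiagonal.antidiagonal n,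
        n.choose k.2 * x ^ k.1 * (y ^ k.2 / (k.2 + 1)) =
      ((x + y) ^ (n + 1) - x ^ (n + 1)) / (n + 1) := by
  rw [add_pow_eq_sum_antidiagonal, Finset.Nat.sum_antidiagonal_succ']
  simp only [Nat.choose_zero_right, Nat.cast_one, one_mul, pow_zero, mul_one, add_sub_cancel_left]
  rw [Finset.mul_sum, Finset.sum_div]
  refine Finset.sum_congr rfl fun k _ => ?_
  have hchoose : ((n + 1 : ℕ) : ℝ) * n.choose k.2 = (n + 1).choose (k.2 + 1) * (k.2 + 1 : ℕ) := by
    exact_mod_cast Nat.add_one_mul_choose_eq n k.2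
  push_cast at hchoose
  field_simp
  linear_combination (x ^ k.1 * y ^ k.2 * y) * hchoose

theorem integral_cos_mul_besselClifford_zero {a : ℝ} (ha : 0 ≤ a) (α q : ℝ) :
    ∫ u in (-a)..a, Real.cos (α * u) * besselClifford 0 (q * (a ^ 2 - u ^ 2)) =
      2 * sinhSqrt (4 * q - α ^ 2) a := by
  have hterm (k : ℕ) (z : ℝ) :
      q ^ k / (k.factorial : ℝ) ^ 2 * z ^ k = (q * z) ^ k / (k.factorial * (k + 0).factorial) := by
    rw [add_zero, mul_pow]
    ring
  have hb : Summable fun k => |q ^ k / (k.factorial : ℝ) ^ 2| * (a ^ 2) ^ k :=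
    (hasSum_besselClifford 0 (q * a ^ 2)).summable.norm.congr fun k => by
      rw [← hterm, norm_mul, Real.norm_eq_abs, Real.norm_of_nonneg (by positivity)]
  have h := hasSum_integral_cos_mul ha α hb
  simp only [hterm] at h
  refine h.unique (((hasSum_sinhSqrt (4 * q - α ^ 2) a).mul_left 2).congr_fun fun n => ?_)
  simp only [← mul_pow]
  rw [← add_pow_eq_sum_antidiagonal]
  ring

theorem integral_cos_mul_besselClifford_one {a : ℝ} (ha : 0 ≤ a) (α q : ℝ) :
    2 * q * a * ∫ u in (-a)..a, Real.cos (α * u) * besselClifford 1 (q * (a ^ 2 - u ^ 2)) =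
      2 * (coshSqrt (4 * q - α ^ 2) a - Real.cos (α * a)) := by
  have hterm (k : ℕ) (z : ℝ) : q ^ k / (k + 1) / (k.factorial : ℝ) ^ 2 * z ^ k =
      (q * z) ^ k / (k.factorial * (k + 1).factorial) := by
    rw [Nat.factorial_succ, mul_pow]
    push_cast
    field_simp
  have hb : Summable fun k : ℕ => |q ^ k / (k + 1) / (k.factorial : ℝ) ^ 2| * (a ^ 2) ^ k :=
    (hasSum_besselClifford 1 (q * a ^ 2)).summable.norm.congr fun k => by
      rw [← hterm, norm_mul, Real.norm_eq_abs, Real.norm_of_nonneg (by positivity)]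
  have h := hasSum_integral_cos_mul ha α hb
  simp only [hterm] at h
  have hcosh := (hasSum_nat_add_iff' 1).2 (hasSum_coshSqrt (4 * q - α ^ 2) a)
  have hcos := (hasSum_nat_add_iff' 1).2 (Real.hasSum_cos (α * a))
  refine (h.mul_left (2 * q * a)).unique ?_
  convert (hcosh.sub hcos).mul_left 2 using 1
  · ext n
    have hbinom := mul_sum_antidiagonal_choose_mul_pow_div (-α ^ 2) (4 * q) n
    have hsign : (-1) ^ (n + 1) * (α * a) ^ (2 * (n + 1)) =
        (-α ^ 2) ^ (n + 1) * a ^ (2 * (n + 1)) := by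
      rw [neg_pow (α ^ 2), mul_pow, pow_mul α, mul_assoc]
    rw [show 4 * q - α ^ 2 = -α ^ 2 + 4 * q by ring, hsign, ← sub_div, ← sub_mul,
      (div_eq_iff (by positivity)).1 hbinom.symm]
    simp only [mul_div_assoc', ← mul_pow]
    rw [show 2 * (n + 1) = 2 * n + 1 + 1 by ring, Nat.factorial_succ (2 * n + 1)]
    push_cast
    field_simp
    ring
  · simp

end BesselTransform

section TelegraphLaw

/-- The density of the absolutely continuous part of `telegraphLaw κ a`. -/
noncomputable def telegraphDensity (κ a u : ℝ) : ℝ :=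
  Real.exp (-(κ * a)) / 2 *
    (κ * besselClifford 0 (κ ^ 2 / 4 * (a ^ 2 - u ^ 2)) +
      2 * (κ ^ 2 / 4) * a * besselClifford 1 (κ ^ 2 / 4 * (a ^ 2 - u ^ 2)))

/-- The law at time `a` of the symmetric telegraph process with unit speed and rate of reversal `κ`.
The atoms at `±a` carry the paths without a reversal. -/
noncomputable def telegraphLaw (κ a : ℝ) : Measure ℝ :=
  ENNReal.ofReal (Real.exp (-(κ * a)) / 2) • (Measure.dirac a + Measure.dirac (-a)) +
    (volume.restrict (Set.Ioo (-a) a)).withDensity fun u => ENNReal.ofReal (telegraphDensity κ a u)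

theorem continuous_telegraphDensity (κ a : ℝ) : Continuous (telegraphDensity κ a) := by
  have h₀ := continuous_besselClifford 0
  have h₁ := continuous_besselClifford 1
  unfold telegraphDensity
  fun_prop

theorem telegraphDensity_neg (κ a u : ℝ) : telegraphDensity κ a (-u) = telegraphDensity κ a u := by
  rw [telegraphDensity, neg_sq, telegraphDensity]

theorem telegraphDensity_nonneg {κ a u : ℝ} (hκ : 0 ≤ κ) (hu : |u| ≤ a) :
    0 ≤ telegraphDensity κ a u := by
  have ha : 0 ≤ a := (abs_nonneg u).trans hu
  have hsq : 0 ≤ a ^ 2 - u ^ 2 := sub_nonneg.2 (sq_le_sq' (abs_le.1 hu).1 (abs_le.1 hu).2)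
  have h₀ := besselClifford_nonneg 0 (by positivity : 0 ≤ κ ^ 2 / 4 * (a ^ 2 - u ^ 2))
  have h₁ := besselClifford_nonneg 1 (by positivity : 0 ≤ κ ^ 2 / 4 * (a ^ 2 - u ^ 2))
  unfold telegraphDensity
  positivity

theorem isFiniteMeasure_withDensity_telegraphDensity (κ a : ℝ) :
    IsFiniteMeasure ((volume.restrict (Set.Ioo (-a) a)).withDensity
      fun u => ENNReal.ofReal (telegraphDensity κ a u)) :=
  isFiniteMeasure_withDensity_ofReal (((continuous_telegraphDensity κ a).integrableOn_Icc).mono_set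
    Set.Ioo_subset_Icc_self).hasFiniteIntegral

instance isFiniteMeasure_telegraphLaw (κ a : ℝ) : IsFiniteMeasure (telegraphLaw κ a) := by
  have hdens := isFiniteMeasure_withDensity_telegraphDensity κ a
  have hatoms : IsFiniteMeasure (ENNReal.ofReal (Real.exp (-(κ * a)) / 2) •
      (Measure.dirac a + Measure.dirac (-a))) := Measure.smul_finite _ ENNReal.ofReal_ne_top
  unfold telegraphLaw
  infer_instance

theorem telegraphLaw_restrict_Ioo (κ a : ℝ) :
    (telegraphLaw κ a).restrict (Set.Ioo (-a) a) =
      (volume.restrict (Set.Ioo (-a) a)).withDensity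
        fun u => ENNReal.ofReal (telegraphDensity κ a u) := by
  classical
  have hI : MeasurableSet (Set.Ioo (-a) a) := measurableSet_Ioo
  rw [telegraphLaw, Measure.restrict_add, Measure.restrict_smul, Measure.restrict_add,
    restrict_dirac' hI, restrict_dirac' hI, if_neg (fun h => lt_irrefl _ h.2),
    if_neg (fun h => lt_irrefl _ h.1), restrict_withDensity hI, Measure.restrict_restrict hI,
    Set.inter_self, add_zero, smul_zero, zero_add]

theorem integral_cos_mul_telegraphDensity (κ : ℝ) {a : ℝ} (ha : 0 ≤ a) (α : ℝ) :
    ∫ u in (-a)..a, Real.cos (α * u) * telegraphDensity κ a u =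
      telegraphChar κ α a - Real.exp (-(κ * a)) * Real.cos (α * a) := by
  have h₀ := continuous_besselClifford 0
  have h₁ := continuous_besselClifford 1
  have hsplit (u : ℝ) : Real.cos (α * u) * telegraphDensity κ a u =
      Real.exp (-(κ * a)) / 2 * (κ *
          (Real.cos (α * u) * besselClifford 0 (κ ^ 2 / 4 * (a ^ 2 - u ^ 2))) +
        2 * (κ ^ 2 / 4) * a *
          (Real.cos (α * u) * besselClifford 1 (κ ^ 2 / 4 * (a ^ 2 - u ^ 2)))) := by
    rw [telegraphDensity]
    ring
  simp only [hsplit]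
  rw [intervalIntegral.integral_const_mul,
    intervalIntegral.integral_add (Continuous.intervalIntegrable (by fun_prop) _ _)
      (Continuous.intervalIntegrable (by fun_prop) _ _),
    intervalIntegral.integral_const_mul, intervalIntegral.integral_const_mul,
    integral_cos_mul_besselClifford_zero ha, integral_cos_mul_besselClifford_one ha,
    mul_div_cancel₀ _ four_ne_zero, telegraphChar]
  ring

theorem integral_exp_mul_of_even {f : ℝ → ℝ} (hf : Continuous f) (heven : ∀ u, f (-u) = f u)
    (a α : ℝ) :
    ∫ u in (-a)..a, Complex.exp (α * u * Complex.I) * f u =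
      ∫ u in (-a)..a, Real.cos (α * u) * f u := by
  have hodd : ∫ u in (-a)..a, Real.sin (α * u) * f u = 0 := by
    have h := intervalIntegral.integral_comp_neg (a := -a) (b := a)
      fun u => Real.sin (α * u) * f u
    simp only [heven, mul_neg, Real.sin_neg, neg_mul, intervalIntegral.integral_neg, neg_neg] at h
    linarith
  have hexp (u : ℝ) : Complex.exp (α * u * Complex.I) * f u =
      ((Real.cos (α * u) * f u : ℝ) : ℂ) + ((Real.sin (α * u) * f u : ℝ) : ℂ) * Complex.I := by
    rw [Complex.exp_mul_I]
    push_cast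
    ring
  simp only [hexp]
  rw [intervalIntegral.integral_add (Continuous.intervalIntegrable (by fun_prop) _ _)
      (Continuous.intervalIntegrable (by fun_prop) _ _), intervalIntegral.integral_mul_const,
    intervalIntegral.integral_ofReal, intervalIntegral.integral_ofReal, hodd, Complex.ofReal_zero,
    zero_mul, add_zero]

theorem charFun_withDensity_telegraphDensity {κ a : ℝ} (hκ : 0 ≤ κ) (ha : 0 ≤ a) (α : ℝ) :
    charFun ((volume.restrict (Set.Ioo (-a) a)).withDensity
        fun u => ENNReal.ofReal (telegraphDensity κ a u)) α =
      (telegraphChar κ α a - Real.exp (-(κ * a)) * Real.cos (α * a) : ℝ) := by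
  have hd := continuous_telegraphDensity κ a
  rw [charFun_apply_real, integral_withDensity_eq_integral_toReal_smul hd.measurable.ennreal_ofReal
      (by simp), ← integral_cos_mul_telegraphDensity κ ha,
    ← integral_exp_mul_of_even hd (telegraphDensity_neg κ a),
    intervalIntegral.integral_of_le (by linarith), integral_Ioc_eq_integral_Ioo]
  refine setIntegral_congr_fun measurableSet_Ioo fun u hu => ?_
  simp only [ENNReal.toReal_ofReal (telegraphDensity_nonneg hκ (abs_le.2 ⟨hu.1.le, hu.2.le⟩)),
    Complex.real_smul, mul_comm]

theorem charFun_add_measure (μ ν : Measure ℝ) [IsFiniteMeasure μ] [IsFiniteMeasure ν] (α : ℝ) :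
    charFun (μ + ν) α = charFun μ α + charFun ν α := by
  have hint (ρ : Measure ℝ) [IsFiniteMeasure ρ] :
      Integrable (fun u : ℝ => Complex.exp (α * u * Complex.I)) ρ :=
    .of_bound (C := 1) (by fun_prop) (ae_of_all _ fun u => by
      rw [← Complex.ofReal_mul, Complex.norm_exp_ofReal_mul_I])
  simp only [charFun_apply_real]
  exact integral_add_measure (hint μ) (hint ν)

theorem charFun_dirac_add_dirac_neg (a α : ℝ) :
    charFun (Measure.dirac a + Measure.dirac (-a)) α = 2 * Real.cos (α * a) := by
  rw [charFun_add_measure, charFun_apply_real, charFun_apply_real, integral_dirac, integral_dirac,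
    Complex.ofReal_cos, Complex.two_cos]
  push_cast
  ring_nf

theorem charFun_telegraphLaw {κ a : ℝ} (hκ : 0 ≤ κ) (ha : 0 ≤ a) (α : ℝ) :
    charFun (telegraphLaw κ a) α = telegraphChar κ α a := by
  have hdens := isFiniteMeasure_withDensity_telegraphDensity κ a
  have hatoms : charFun (ENNReal.ofReal (Real.exp (-(κ * a)) / 2) •
      (Measure.dirac a + Measure.dirac (-a))) α = Real.exp (-(κ * a)) * Real.cos (α * a) := by
    rw [charFun_apply, integral_smul_measure, ← charFun_apply, charFun_dirac_add_dirac_neg,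
      ENNReal.toReal_ofReal (by positivity), Complex.real_smul]
    push_cast
    ring
  have := Measure.smul_finite (Measure.dirac a + Measure.dirac (-a))
    (ENNReal.ofReal_ne_top (r := Real.exp (-(κ * a)) / 2))
  rw [telegraphLaw, charFun_add_measure, hatoms, charFun_withDensity_telegraphDensity hκ ha]
  push_cast
  ring

end TelegraphLaw

section SumDiff

/-- The coordinates `(x + y, x - y)`, in which the components of the motion are independent. -/
noncomputable def sumDiff : ℝ × ℝ →L[ℝ] ℝ × ℝ :=
  (Matrix.toLin (Module.Basis.finTwoProd ℝ) (Module.Basis.finTwoProd ℝ)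
    !![1, 1; 1, -1]).toContinuousLinearMap

theorem sumDiff_apply (z : ℝ × ℝ) : sumDiff z = (z.1 + z.2, z.1 - z.2) := by
  rw [sumDiff, Matrix.toLin_finTwoProd_toContinuousLinearMap]
  simp [sub_eq_add_neg]

theorem det_sumDiff : sumDiff.det = -2 := by
  rw [sumDiff, LinearMap.det_toContinuousLinearMap, LinearMap.det_toLin, Matrix.det_fin_two_of]
  norm_num

theorem injective_sumDiff : Function.Injective sumDiff := by
  intro z w h
  simp only [sumDiff_apply, Prod.mk.injEq] at h
  ext <;> linarith [h.1, h.2]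

theorem sumDiff_dirVec (j : Fin 4) : sumDiff (dirVec j) = (signU j, signV j) := by
  have h₂ : Real.pi * 2 / 2 = Real.pi := by ring
  have h₃ : Real.pi * 3 / 2 = Real.pi + Real.pi / 2 := by ring
  rw [sumDiff_apply]
  fin_cases j <;> simp [dirVec, signU, signV, h₂, h₃, Real.cos_add, Real.sin_add]

variable {Ω : Type*} {N : ℝ≥0 → Ω → ℕ} {ξ : ℕ → Ω → Fin 4}

theorem intervalIntegrable_direction {ω : Ω} (hmono : Monotone fun t => N t ω) (b : Fin 4 → ℝ)
    (t₁ t₂ : ℝ) :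
    IntervalIntegrable (fun s : ℝ => b (direction N ξ s.toNNReal ω)) volume t₁ t₂ :=
  intervalIntegrable_of_bound ((Measurable.of_discrete (f := fun k => b (ξ k ω))).comp
    (measurable_comp_toNNReal hmono)).stronglyMeasurable (fun _ => norm_le_pi_norm b _) t₁ t₂

theorem mul_fst_add_mul_snd_sumDiff_position {ω : Ω} (hmono : Monotone fun t => N t ω)
    (c t α β : ℝ) :
    α * (sumDiff (position N ξ c t ω)).1 + β * (sumDiff (position N ξ c t ω)).2 =
      ∫ s in (0 : ℝ)..t, (c * α * signU (direction N ξ s.toNNReal ω) +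
        c * β * signV (direction N ξ s.toNNReal ω)) := by
  have hsign (j : Fin 4) : c * α * signU j + c * β * signV j =
      (α + β) * (c * (dirVec j).1) + (α - β) * (c * (dirVec j).2) := by
    obtain ⟨hU, hV⟩ := Prod.mk.inj (sumDiff_dirVec j ▸ sumDiff_apply (dirVec j))
    rw [hU, hV]
    ring
  have hint₁ := intervalIntegrable_direction (ξ := ξ) hmono (fun j => c * (dirVec j).1) 0 t
  have hint₂ := intervalIntegrable_direction (ξ := ξ) hmono (fun j => c * (dirVec j).2) 0 t
  simp only [hsign]
  rw [intervalIntegral.integral_add (hint₁.const_mul _) (hint₂.const_mul _),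
    intervalIntegral.integral_const_mul (α + β), intervalIntegral.integral_const_mul (α - β),
    sumDiff_apply, position]
  ring

end SumDiff

section LawOfPosition

variable {Ω : Type*} [MeasurableSpace Ω] {P : Measure Ω} {N : ℝ≥0 → Ω → ℕ} {ξ : ℕ → Ω → Fin 4}
  {lam p c t : ℝ}

theorem IsDirectionMechanism.aemeasurable_position (hmech : IsDirectionMechanism N ξ lam p P)
    (c : ℝ) (ht : 0 < t) : AEMeasurable (position N ξ c t) P := by
  lift t to ℝ≥0 using ht.le
  have hcoord (b : Fin 4 → ℝ) := hmech.poisson.aemeasurable_integral hmech.chain.isMarkovChain b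
    (NNReal.coe_pos.1 ht)
  exact (hcoord fun j => c * (dirVec j).1).prodMk (hcoord fun j => c * (dirVec j).2)

theorem IsDirectionMechanism.map_sumDiff_position [IsProbabilityMeasure P]
    (hmech : IsDirectionMechanism N ξ lam p P) (hlam : 0 ≤ lam) (hp0 : 0 ≤ p) (hp1 : p ≤ 1)
    (hc : 0 < c) (ht : 0 < t) :
    (P.map (position N ξ c t)).map sumDiff =
      (telegraphLaw (lam * (1 - p) / c) (c * t)).prod (telegraphLaw (lam * p / c) (c * t)) := by
  have hκ : 0 ≤ lam * (1 - p) / c := div_nonneg (mul_nonneg hlam (sub_nonneg.2 hp1)) hc.le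
  have hκ' : 0 ≤ lam * p / c := by positivity
  have hct : 0 ≤ c * t := by positivity
  refine charFun_eq_prod_iff.1 fun z => ?_
  have hchar := hmech.integral_exp_integral hlam (t := ⟨t, ht.le⟩) ht (c * z.fst) (c * z.snd)
  rw [charFun_telegraphLaw hκ hct, charFun_telegraphLaw hκ' hct, ← telegraphChar_mul_mul,
    ← telegraphChar_mul_mul, mul_div_cancel₀ _ hc.ne', mul_div_cancel₀ _ hc.ne']
  refine Eq.trans ?_ hchar
  rw [charFun_apply, integral_map (by fun_prop) (by fun_prop), integral_map (by fun_prop)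
    (by fun_prop), integral_map (hmech.aemeasurable_position c ht) (by fun_prop)]
  refine integral_congr_ae ?_
  filter_upwards [hmech.poisson.monotone] with ω hmono
  have hinner := mul_fst_add_mul_snd_sumDiff_position (ξ := ξ) hmono c t z.fst z.snd
  simp only [WithLp.prod_inner_apply, RCLike.inner_apply, conj_trivial]
  rw [mul_comm Complex.I]
  exact congrArg (fun x : ℝ => Complex.exp (x * Complex.I)) hinner

theorem prod_telegraphLaw_apply {κ κ' a : ℝ} {B : Set (ℝ × ℝ)} (hB : MeasurableSet B)
    (hBI : B ⊆ Set.Ioo (-a) a ×ˢ Set.Ioo (-a) a) :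
    ((telegraphLaw κ a).prod (telegraphLaw κ' a)) B =
      ∫⁻ z in B, ENNReal.ofReal (telegraphDensity κ a z.1) *
        ENNReal.ofReal (telegraphDensity κ' a z.2) := by
  have hd := (continuous_telegraphDensity κ a).measurable.ennreal_ofReal
  have hd' := (continuous_telegraphDensity κ' a).measurable.ennreal_ofReal
  rw [← Measure.restrict_eq_self _ hBI, ← Measure.prod_restrict, telegraphLaw_restrict_Ioo,
    telegraphLaw_restrict_Ioo, prod_withDensity hd hd', withDensity_apply _ hB,
    Measure.prod_restrict, Measure.restrict_restrict hB, Set.inter_eq_left.2 hBI]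
  rfl

end LawOfPosition

section InteriorDensity

variable {lam p c x y t w : ℝ}

theorem abs_add_lt_and_abs_sub_lt {a : ℝ} (h : |x| + |y| < a) : |x + y| < a ∧ |x - y| < a :=
  ⟨(abs_add_le x y).trans_lt h, (abs_sub x y).trans_lt h⟩

theorem sq_sub_sq_pos_of_abs_lt (h : |w| < c * t) : 0 < c ^ 2 * t ^ 2 - w ^ 2 := by
  rw [← mul_pow, sub_pos, ← sq_abs w]
  gcongr

theorem differentiableAt_besselI0_sqrt (m : ℝ) (h : |w| < c * t) :
    DifferentiableAt ℝ (fun s => besselI0 (m * Real.sqrt (c ^ 2 * s ^ 2 - w ^ 2))) t :=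
  (hasDerivAt_besselI0_sqrt m c (sq_sub_sq_pos_of_abs_lt h)).differentiableAt

theorem interiorDensity_eq (hc : 0 < c) (h : |x| + |y| < c * t) :
    interiorDensity lam p c x y t =
      2 * (telegraphDensity (lam * (1 - p) / c) (c * t) (x + y) *
        telegraphDensity (lam * p / c) (c * t) (x - y)) := by
  obtain ⟨hadd, hsub⟩ := abs_add_lt_and_abs_sub_lt h
  have hadd := sq_sub_sq_pos_of_abs_lt hadd
  have hsub := sq_sub_sq_pos_of_abs_lt hsub
  have hexp : Real.exp (-(lam * t)) =
      Real.exp (-(lam * (1 - p) / c * (c * t))) * Real.exp (-(lam * p / c * (c * t))) := by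
    rw [← Real.exp_add]
    congr 1
    field_simp
    ring
  rw [interiorDensity, (hasDerivAt_besselI0_sqrt (lam * (1 - p) / c) c hadd).deriv,
    (hasDerivAt_besselI0_sqrt (lam * p / c) c hsub).deriv, besselI0_mul_sqrt _ hadd.le,
    besselI0_mul_sqrt _ hsub.le, hexp, telegraphDensity, telegraphDensity, mul_pow c t]
  field_simp

theorem interiorDensity_nonneg (hlam : 0 ≤ lam) (hp0 : 0 ≤ p) (hp1 : p ≤ 1) (hc : 0 < c)
    (h : |x| + |y| < c * t) : 0 ≤ interiorDensity lam p c x y t := by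
  obtain ⟨hadd, hsub⟩ := abs_add_lt_and_abs_sub_lt h
  have hκ : 0 ≤ lam * (1 - p) / c := div_nonneg (mul_nonneg hlam (sub_nonneg.2 hp1)) hc.le
  rw [interiorDensity_eq hc h]
  exact mul_nonneg zero_le_two (mul_nonneg (telegraphDensity_nonneg hκ hadd.le)
    (telegraphDensity_nonneg (by positivity) hsub.le))

theorem measurableSet_openSquare (c t : ℝ) : MeasurableSet (openSquare c t) :=
  measurableSet_lt (by fun_prop) measurable_const

theorem openSquare_subset_Icc (c t : ℝ) :
    openSquare c t ⊆ Set.Icc (-(c * t), -(c * t)) (c * t, c * t) := by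
  rintro ⟨x, y⟩ (h : |x| + |y| < c * t)
  have hx := abs_le.1 ((le_add_of_nonneg_right (abs_nonneg y)).trans h.le)
  have hy := abs_le.1 ((le_add_of_nonneg_left (abs_nonneg x)).trans h.le)
  exact ⟨⟨hx.1, hy.1⟩, hx.2, hy.2⟩

theorem integrableOn_interiorDensity (lam p : ℝ) (hc : 0 < c) (t : ℝ) :
    IntegrableOn (fun z : ℝ × ℝ => interiorDensity lam p c z.1 z.2 t) (openSquare c t) := by
  have hadd := continuous_telegraphDensity (lam * (1 - p) / c) (c * t)
  have hsub := continuous_telegraphDensity (lam * p / c) (c * t)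
  have hcont : Continuous fun z : ℝ × ℝ =>
      2 * (telegraphDensity (lam * (1 - p) / c) (c * t) (z.1 + z.2) *
        telegraphDensity (lam * p / c) (c * t) (z.1 - z.2)) := by
    fun_prop
  exact (hcont.integrableOn_Icc.mono_set (openSquare_subset_Icc c t)).congr_fun
    (fun z hz => (interiorDensity_eq hc hz).symm) (measurableSet_openSquare c t)

end InteriorDensity

namespace IsDirectionMechanism

variable {Ω : Type*} [MeasurableSpace Ω] {P : Measure Ω} [IsProbabilityMeasure P]
  {N : ℝ≥0 → Ω → ℕ} {ξ : ℕ → Ω → Fin 4} {lam p c t : ℝ}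

theorem map_position_apply (hmech : IsDirectionMechanism N ξ lam p P) (hlam : 0 ≤ lam)
    (hp0 : 0 ≤ p) (hp1 : p ≤ 1) (hc : 0 < c) (ht : 0 < t) {A : Set (ℝ × ℝ)}
    (hA : MeasurableSet A) (hAs : A ⊆ openSquare c t) :
    P.map (position N ξ c t) A =
      ∫⁻ z in A, ENNReal.ofReal (interiorDensity lam p c z.1 z.2 t) := by
  have hrA : MeasurableSet (sumDiff '' A) :=
    hA.image_of_continuousOn_injOn sumDiff.continuous.continuousOn injective_sumDiff.injOn
  have hsub : sumDiff '' A ⊆ Set.Ioo (-(c * t)) (c * t) ×ˢ Set.Ioo (-(c * t)) (c * t) := by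
    rintro _ ⟨z, hz, rfl⟩
    rw [sumDiff_apply]
    exact (abs_add_lt_and_abs_sub_lt (hAs hz)).imp abs_lt.1 abs_lt.1
  calc P.map (position N ξ c t) A
    _ = (P.map (position N ξ c t)).map sumDiff (sumDiff '' A) := by
      rw [Measure.map_apply sumDiff.continuous.measurable hrA, injective_sumDiff.preimage_image]
    _ = ∫⁻ z in A, ENNReal.ofReal |sumDiff.det| *
          (ENNReal.ofReal (telegraphDensity (lam * (1 - p) / c) (c * t) (sumDiff z).1) *
            ENNReal.ofReal (telegraphDensity (lam * p / c) (c * t) (sumDiff z).2)) := by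
      rw [hmech.map_sumDiff_position hlam hp0 hp1 hc ht, prod_telegraphLaw_apply hrA hsub,
        lintegral_image_eq_lintegral_abs_det_fderiv_mul volume hA
          (fun z _ => sumDiff.hasFDerivWithinAt) injective_sumDiff.injOn]
    _ = ∫⁻ z in A, ENNReal.ofReal (interiorDensity lam p c z.1 z.2 t) := by
      refine setLIntegral_congr_fun hA fun z hz => ?_
      have hnonneg : 0 ≤ telegraphDensity (lam * (1 - p) / c) (c * t) (z.1 + z.2) :=
        telegraphDensity_nonneg (div_nonneg (mul_nonneg hlam (sub_nonneg.2 hp1)) hc.le)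
          (abs_add_lt_and_abs_sub_lt (hAs hz)).1.le
      simp only [det_sumDiff, sumDiff_apply, abs_neg, abs_two]
      rw [interiorDensity_eq hc (hAs hz), ENNReal.ofReal_mul zero_le_two,
        ENNReal.ofReal_mul hnonneg]

theorem map_position_real_apply (hmech : IsDirectionMechanism N ξ lam p P) (hlam : 0 ≤ lam)
    (hp0 : 0 ≤ p) (hp1 : p ≤ 1) (hc : 0 < c) (ht : 0 < t) {A : Set (ℝ × ℝ)}
    (hA : MeasurableSet A) (hAs : A ⊆ openSquare c t) :
    (P.map (position N ξ c t)).real A = ∫ z in A, interiorDensity lam p c z.1 z.2 t := by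
  rw [measureReal_def, hmech.map_position_apply hlam hp0 hp1 hc ht hA hAs,
    integral_eq_lintegral_of_nonneg_ae
      ((ae_restrict_mem hA).mono fun z hz => interiorDensity_nonneg hlam hp0 hp1 hc (hAs hz))
      ((integrableOn_interiorDensity lam p hc t).mono_set hAs).aestronglyMeasurable]

end IsDirectionMechanism

end PlanarMotion

theorem theorem3 {Ω : Type*} [MeasurableSpace Ω] (P : Measure Ω) [IsProbabilityMeasure P]
    (lam p c : ℝ) (hlam : 0 < lam) (hp0 : 0 < p) (hp1 : p < 1) (hc : 0 < c)
    (N : ℝ≥0 → Ω → ℕ) (ξ : ℕ → Ω → Fin 4)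
    (hmotion : PlanarMotion.IsDirectionMechanism N ξ lam p P)
    (t : ℝ) (ht : 0 < t) :
    -- the time derivatives in the formula exist
    (∀ x y : ℝ, |x| + |y| < c * t →
      DifferentiableAt ℝ (fun s : ℝ => PlanarMotion.besselI0
        (lam * (1 - p) / c * Real.sqrt (c ^ 2 * s ^ 2 - (x + y) ^ 2))) t ∧
      DifferentiableAt ℝ (fun s : ℝ => PlanarMotion.besselI0
        (lam * p / c * Real.sqrt (c ^ 2 * s ^ 2 - (x - y) ^ 2))) t) ∧
    AEMeasurable (PlanarMotion.position N ξ c t) P ∧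
    IntegrableOn (fun z : ℝ × ℝ => PlanarMotion.interiorDensity lam p c z.1 z.2 t)
      (PlanarMotion.openSquare c t) volume ∧
    ∀ A : Set (ℝ × ℝ), MeasurableSet A → A ⊆ PlanarMotion.openSquare c t →
      (P.map (PlanarMotion.position N ξ c t)).real A =
        ∫ z in A, PlanarMotion.interiorDensity lam p c z.1 z.2 t := by
  refine ⟨fun x y h => ?_, hmotion.aemeasurable_position c ht,
    PlanarMotion.integrableOn_interiorDensity lam p hc t,
    fun A => hmotion.map_position_real_apply hlam.le hp0.le hp1.le hc ht⟩
  exact (PlanarMotion.abs_add_lt_and_abs_sub_lt h).imp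
    (PlanarMotion.differentiableAt_besselI0_sqrt _)
    (PlanarMotion.differentiableAt_besselI0_sqrt _)
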